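/- Let $A=(A_{ij})_{1\le i,j\le l}$ be the Cartan matrix of a finite-dimensional simple Lie algebra $\mathfrak g$, with positive rationals $d_i$ such that $(\alpha_i|\alpha_j)=d_iA_{ij}$ is symmetric (for the standard normalized form the largest $d_i$ is $1$). Let $q=e^h\in\mathbb C^*$ not be a root of unity, and put $q^a=e^{ah}$ for $a\in\mathbb Q$, $q_i=q^{d_i}$, $[a]=\frac{q^a-q^{-a}}{q-q^{-1}}$, $\delta(u)=\sum_{n\in\mathbb Z}u^n$. Let $U_q(\widehat{\mathfrak g})$ be the untwisted (type one) quantum affine algebra in Drinfeld's realization: the associative $\mathbb C$-algebra generated by central elements $\gamma^{\pm1/2}$ and by $d$, $k_i^{\pm1}$, $a_i(n)$ $(n\ne0)$, $x_i^\pm(n)$ $(n\in\mathbb Z)$, where the $k_i$ commute with each other, with $d$ and with all $a_j(n)$, and, with $x_i^\pm(z)=\sum_{n\in\mathbb Z}x_i^\pm(n)z^{-n}$, $$k_ix_j^\pm(n)k_i^{-1}=q^{\pm(\alpha_i|\alpha_j)}x_j^\pm(n),\quad [d,a_i(n)]=na_i(n),\quad [d,x_i^\pm(n)]=nx_i^\pm(n),$$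 $$[a_i(m),a_j(n)]=\delta_{m,-n}\tfrac{[(\alpha_i|\alpha_j)m]}{m}\tfrac{\gamma^m-\gamma^{-m}}{q-q^{-1}},\quad [a_i(m),x_j^\pm(n)]=\pm\tfrac{[(\alpha_i|\alpha_j)m]}{m}\gamma^{\mp|m|/2}x_j^\pm(m+n),$$ $$(z-q^{\pm(\alpha_i|\alpha_j)}w)x_i^\pm(z)x_j^\pm(w)=(q^{\pm(\alpha_i|\alpha_j)}z-w)x_j^\pm(w)x_i^\pm(z),$$ $$[x_i^+(z),x_j^-(w)]=\tfrac{\delta_{ij}}{q_i-q_i^{-1}}\{\delta(\gamma^{-1}z/w)\psi_i(\gamma^{1/2}w)-\delta(\gamma z/w)\phi_i(\gamma^{1/2}z)\},$$ where $\psi_i(z)=k_i\exp\big((q-q^{-1})\sum_{n>0}a_i(n)z^{-n}\big)$ and $\phi_i(z)=k_i^{-1}\exp\big((q^{-1}-q)\sum_{n>0}a_i(-n)z^n\big)$, together with the Serre relations, for $i\neq j$ and $N=1-A_{ij}$, $$\mathrm{Sym}_{z_1,\dots,z_N}\sum_{s=0}^{N}(-1)^s\begin{bmatrix}N\\s\end{bmatrix}_{q_i}x_i^\pm(z_1)\cdots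 x_i^\pm(z_s)x_j^\pm(w)x_i^\pm(z_{s+1})\cdots x_i^\pm(z_N)=0.$$ Let $k\in\mathbb Q$, $k\ne0$, and let $V$ be a $U_q(\widehat{\mathfrak g})$-module of level $k$ (that is, $\gamma^{1/2}$ acts as $q^{k/2}$) which is the sum of its subspaces $V_c=\{v: dv=cv\}$, $c\in\mathbb C$, and such that for every $c\in\mathbb C$ one has $V_{c+n}=0$ for all sufficiently large integers $n$. On $V$ put $$E_-^\pm(\alpha_i,z)=\exp\Big(\mp\sum_{n\ge1}\tfrac{q^{\mp kn/2}}{[kn]}a_i(-n)z^n\Big),\qquad E_+^\pm(\alpha_i,z)=\exp\Big(\pm\sum_{n\ge1}\tfrac{q^{\mp kn/2}}{[kn]}a_i(n)z^{-n}\Big),$$ $$Z^\pm(\alpha_i,z)=E_-^\pm(\alpha_i,z)\,x_i^\pm(z)\,E_+^\pm(\alpha_i,z),\qquad (1-u)_{q^{2k}}^{a/k}=\exp\Big(-\sum_{n\ge1}\tfrac{[an]}{n[kn]}u^n\Big)\quad(a\in\mathbb Q),$$ the last series being $(q^{-a+k}u;q^{2k})_\infty/(q^{a+k}u;q^{2k})_\infty$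 when $|q^{2k}|<1$. Then the components of $Z^\pm(\alpha_i,z)=\sum_{n\in\mathbb Z}Z_i^\pm(n)z^{-n}$ are well-defined linear operators on $V$ (on each vector they are sums with finitely many nonzero terms), for each $v\in V$ one has $Z_i^\pm(n)v=0$ for all sufficiently large $n$, and for all $i,j$ and both signs $$(1-q^{\mp k}w/z)_{q^{2k}}^{(\alpha_i|\alpha_j)/k}(z-q^{\pm(\alpha_i|\alpha_j)}w)Z^\pm(\alpha_i,z)Z^\pm(\alpha_j,w)=(1-q^{\mp k}z/w)_{q^{2k}}^{(\alpha_i|\alpha_j)/k}(q^{\pm(\alpha_i|\alpha_j)}z-w)Z^\pm(\alpha_j,w)Z^\pm(\alpha_i,z),$$ $$(1-w/z)_{q^{2k}}^{-(\alpha_i|\alpha_j)/k}Z^+(\alpha_i,z)Z^-(\alpha_j,w)-(1-z/w)_{q^{2k}}^{-(\alpha_i|\alpha_j)/k}Z^-(\alpha_j,w)Z^+(\alpha_i,z)=\frac{\delta_{ij}}{q_i-q_i^{-1}}\{k_i\,\delta(q^{-k}z/w)-k_i^{-1}\,\delta(q^kz/w)\}.$$ (These relations are taken as the defining relations of the homogeneous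 quantum $Z$-algebra.) -/

import Mathlib

open PowerSeries

noncomputable section

namespace QuantumZ

/-! ## Powers of `q`, `q`-numbers, formal exponentials -/

/-- The parameter `q = e^h` is given together with a logarithm `h`, so that all rational powers
`q^a = e^{a h}` are defined compatibly. -/
def qpow (h : ℂ) (a : ℚ) : ℂ := Complex.exp ((a : ℂ) * h)

/-- The `q`-number `[a] = (q^a - q^{-a}) / (q - q^{-1})`. -/
def qnum (h : ℂ) (a : ℚ) : ℂ :=
  (qpow h a - qpow h (-a)) / (qpow h 1 - qpow h (-1))

/-- The `q`-factorial `[n]! = [1] ⋯ [n]` with respect to `q^c`, i.e. built from the numbers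
`(q^{cr} - q^{-cr}) / (q^c - q^{-c})`. -/
def qfactorial (h : ℂ) (c : ℚ) (n : ℕ) : ℂ :=
  ∏ r ∈ Finset.range n,
    (qpow h (c * (r + 1)) - qpow h (-(c * (r + 1)))) / (qpow h c - qpow h (-c))

/-- The Gaussian binomial coefficient `[m]! / ([n]! [m-n]!)` with respect to `q^c`, used for `n ≤ m`. -/
def qbinomial (h : ℂ) (c : ℚ) (m n : ℕ) : ℂ :=
  qfactorial h c m / (qfactorial h c n * qfactorial h c (m - n))

/-- The exponential `∑ f^r / r!` of a formal power series `f` with zero constant term, with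
coefficients in a possibly noncommutative algebra. Since `f` has no constant term, `f^r` contributes
to the coefficient of `X^n` only for `r ≤ n`. -/
def formalExp {A : Type*} [Ring A] [Algebra ℂ A] (f : A⟦X⟧) : A⟦X⟧ :=
  PowerSeries.mk fun n =>
    ∑ r ∈ Finset.range (n + 1), ((r.factorial : ℂ)⁻¹) • PowerSeries.coeff n (f ^ r)

/-- `(1 - u)_{q^{2k}}^{a/k} = exp (- ∑_{n ≥ 1} [a n] / (n [k n]) u^n)` as a power series in `u`. -/
def qPochhammerPow (h : ℂ) (k a : ℚ) : ℂ⟦X⟧ :=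
  formalExp (PowerSeries.mk fun n => -(qnum h (a * n) / ((n : ℂ) * qnum h (k * n))))

/-! ## Cartan data of finite type -/

/-- An indecomposable Cartan matrix of finite type (the Cartan matrix of a finite-dimensional simple
Lie algebra) with positive rationals `d i` such that `(α_i|α_j) = d_i A_{ij}` is symmetric; the
standard normalization of the form is the one in which the largest `d i` is `1`. -/
structure CartanDatum (ι : Type*) [Fintype ι] where
  A : Matrix ι ι ℤ
  d : ι → ℚ
  nonempty : Nonempty ι
  diag : ∀ i, A i i = 2
  offDiag : ∀ i j, i ≠ j → A i j ≤ 0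
  d_pos : ∀ i, 0 < d i
  symm : ∀ i j, d i * (A i j : ℚ) = d j * (A j i : ℚ)
  posDef : ∀ c : ι → ℚ, c ≠ 0 → 0 < ∑ i, ∑ j, c i * (d i * (A i j : ℚ)) * c j
  indecomposable : ∀ s : Set ι, s.Nonempty → sᶜ.Nonempty → ∃ i ∈ s, ∃ j ∈ sᶜ, A i j ≠ 0

/-- The invariant form `(α_i|α_j) = d_i A_{ij}`. -/
def CartanDatum.form {ι : Type*} [Fintype ι] (C : CartanDatum ι) (i j : ι) : ℚ :=
  C.d i * (C.A i j : ℚ)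

/-! ## The quantum affine algebra in Drinfeld's realization -/

/-- The generators: `γ^{±1/2}`, `d`, `k_i^{±1}`, `a_i(n)` for `n ≠ 0`, and `x_i^±(n)`
(the sign is a unit of `ℤ`). -/
inductive Gen (ι : Type*) where
  | gammaHalf : Gen ι
  | gammaHalfInv : Gen ι
  | d : Gen ι
  | k (i : ι) : Gen ι
  | kInv (i : ι) : Gen ι
  | a (i : ι) (n : {n : ℤ // n ≠ 0}) : Gen ι
  | x (ε : ℤˣ) (i : ι) (n : ℤ) : Gen ι

namespace Free

variable {ι : Type*}

/-- A generator in the free algebra. -/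
def gen (g : Gen ι) : FreeAlgebra ℂ (Gen ι) := FreeAlgebra.ι ℂ g

/-- `γ^{m/2}` for an integer `m`. -/
def gammaHalfPow (m : ℤ) : FreeAlgebra ℂ (Gen ι) :=
  gen Gen.gammaHalf ^ m.toNat * gen Gen.gammaHalfInv ^ (-m).toNat

/-- `a_i(n)` for `n ≠ 0`; there is no generator with `n = 0`, and the value there is `0`. -/
def a (i : ι) (n : ℤ) : FreeAlgebra ℂ (Gen ι) :=
  if hn : n ≠ 0 then gen (Gen.a i ⟨n, hn⟩) else 0

/-- `x_i^±(n)`. -/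
def x (ε : ℤˣ) (i : ι) (n : ℤ) : FreeAlgebra ℂ (Gen ι) := gen (Gen.x ε i n)

/-- `ψ_i(n)`, where `∑_{n ≥ 0} ψ_i(n) z^{-n} = k_i exp ((q - q^{-1}) ∑_{n > 0} a_i(n) z^{-n})` and
`ψ_i(n) = 0` for `n < 0`. -/
def psi (h : ℂ) (i : ι) (n : ℤ) : FreeAlgebra ℂ (Gen ι) :=
  if 0 ≤ n then
    gen (Gen.k i) * PowerSeries.coeff n.toNat
      (formalExp (PowerSeries.mk fun m : ℕ => (qpow h 1 - qpow h (-1)) • a i (m : ℤ)))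
  else 0

/-- `φ_i(n)`, where
`∑_{n ≥ 0} φ_i(-n) z^n = k_i^{-1} exp ((q^{-1} - q) ∑_{n > 0} a_i(-n) z^n)` and
`φ_i(n) = 0` for `n > 0`. -/
def phi (h : ℂ) (i : ι) (n : ℤ) : FreeAlgebra ℂ (Gen ι) :=
  if n ≤ 0 then
    gen (Gen.kInv i) * PowerSeries.coeff (-n).toNat
      (formalExp (PowerSeries.mk fun m : ℕ => (qpow h (-1) - qpow h 1) • a i (-(m : ℤ))))
  else 0

end Free

open Free in
/-- The defining relations, written in components with `x_i^±(z) = ∑ x_i^±(n) z^{-n}`. -/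
inductive Rel {ι : Type*} [Fintype ι] (C : CartanDatum ι) (h : ℂ) :
    FreeAlgebra ℂ (Gen ι) → FreeAlgebra ℂ (Gen ι) → Prop
  | gamma_mul_inv : Rel C h (gen Gen.gammaHalf * gen Gen.gammaHalfInv) 1
  | gamma_inv_mul : Rel C h (gen Gen.gammaHalfInv * gen Gen.gammaHalf) 1
  | gamma_central (g : Gen ι) :
      Rel C h (gen Gen.gammaHalf * gen g) (gen g * gen Gen.gammaHalf)
  | k_mul_inv (i : ι) : Rel C h (gen (Gen.k i) * gen (Gen.kInv i)) 1
  | k_inv_mul (i : ι) : Rel C h (gen (Gen.kInv i) * gen (Gen.k i)) 1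
  | k_k (i j : ι) : Rel C h (gen (Gen.k i) * gen (Gen.k j)) (gen (Gen.k j) * gen (Gen.k i))
  | k_d (i : ι) : Rel C h (gen (Gen.k i) * gen Gen.d) (gen Gen.d * gen (Gen.k i))
  | k_a (i j : ι) (n : ℤ) : Rel C h (gen (Gen.k i) * a j n) (a j n * gen (Gen.k i))
  | k_x (ε : ℤˣ) (i j : ι) (n : ℤ) :
      Rel C h (gen (Gen.k i) * x ε j n)
        (qpow h (((ε : ℤ) : ℚ) * C.form i j) • (x ε j n * gen (Gen.k i)))
  | d_a (i : ι) (n : ℤ) :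
      Rel C h (gen Gen.d * a i n - a i n * gen Gen.d) ((n : ℂ) • a i n)
  | d_x (ε : ℤˣ) (i : ι) (n : ℤ) :
      Rel C h (gen Gen.d * x ε i n - x ε i n * gen Gen.d) ((n : ℂ) • x ε i n)
  /- `[a_i(m), a_j(n)] = δ_{m,-n} [(α_i|α_j) m]/m (γ^m - γ^{-m})/(q - q^{-1})` -/
  | a_a (i j : ι) (m n : ℤ) (hm : m ≠ 0) (hn : n ≠ 0) :
      Rel C h (a i m * a j n - a j n * a i m)
        (if m = -n then
          (qnum h (C.form i j * m) / (m : ℂ) / (qpow h 1 - qpow h (-1))) •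
            (gammaHalfPow (2 * m) - gammaHalfPow (-(2 * m)))
        else 0)
  /- `[a_i(m), x_j^±(n)] = ± [(α_i|α_j) m]/m γ^{∓|m|/2} x_j^±(m + n)` -/
  | a_x (ε : ℤˣ) (i j : ι) (m n : ℤ) (hm : m ≠ 0) :
      Rel C h (a i m * x ε j n - x ε j n * a i m)
        ((((ε : ℤ) : ℂ) * (qnum h (C.form i j * m) / (m : ℂ))) •
          (gammaHalfPow (-((ε : ℤ) * |m|)) * x ε j (m + n)))
  /- `(z - q^{±(α_i|α_j)} w) x_i^±(z) x_j^±(w) = (q^{±(α_i|α_j)} z - w) x_j^±(w) x_i^±(z)` -/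
  | x_x (ε : ℤˣ) (i j : ι) (m n : ℤ) :
      Rel C h
        (x ε i (m + 1) * x ε j n
          - qpow h (((ε : ℤ) : ℚ) * C.form i j) • (x ε i m * x ε j (n + 1)))
        (qpow h (((ε : ℤ) : ℚ) * C.form i j) • (x ε j n * x ε i (m + 1))
          - x ε j (n + 1) * x ε i m)
  /- `[x_i^+(z), x_j^-(w)] = δ_{ij}/(q_i - q_i^{-1})
    (δ(γ^{-1} z/w) ψ_i(γ^{1/2} w) - δ(γ z/w) φ_i(γ^{1/2} z))` -/
  | x_plus_minus (i : ι) (m n : ℤ) :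
      Rel C h (x 1 i m * x (-1) i n - x (-1) i n * x 1 i m)
        ((qpow h (C.d i) - qpow h (-C.d i))⁻¹ •
          (gammaHalfPow (m - n) * psi h i (m + n) - gammaHalfPow (n - m) * phi h i (m + n)))
  | x_plus_minus_of_ne (i j : ι) (hij : i ≠ j) (m n : ℤ) :
      Rel C h (x 1 i m * x (-1) j n - x (-1) j n * x 1 i m) 0
  /- the Serre relations, with `N = 1 - A_{ij}` -/
  | serre (ε : ℤˣ) (i j : ι) (hij : i ≠ j) (n : Fin (1 - C.A i j).toNat → ℤ) (m : ℤ) :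
      Rel C h
        (∑ σ : Equiv.Perm (Fin (1 - C.A i j).toNat),
          ∑ s ∈ Finset.range ((1 - C.A i j).toNat + 1),
            ((-1 : ℂ) ^ s * qbinomial h (C.d i) (1 - C.A i j).toNat s) •
              (((List.ofFn fun t => x ε i (n (σ t))).take s).prod * x ε j m *
                ((List.ofFn fun t => x ε i (n (σ t))).drop s).prod))
        0

/-- The quantum affine algebra `U_q(ĝ)` over `ℂ`. -/
def Uq {ι : Type*} [Fintype ι] (C : CartanDatum ι) (h : ℂ) : Type _ := RingQuot (Rel C h)

instance {ι : Type*} [Fintype ι] (C : CartanDatum ι) (h : ℂ) : Ring (Uq C h) :=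
  inferInstanceAs (Ring (RingQuot (Rel C h)))

instance {ι : Type*} [Fintype ι] (C : CartanDatum ι) (h : ℂ) : Algebra ℂ (Uq C h) :=
  inferInstanceAs (Algebra ℂ (RingQuot (Rel C h)))

namespace Uq

variable {ι : Type*} [Fintype ι] (C : CartanDatum ι) (h : ℂ)

/-- The projection from the free algebra. -/
def mk : FreeAlgebra ℂ (Gen ι) →ₐ[ℂ] Uq C h := RingQuot.mkAlgHom ℂ (Rel C h)

def gammaHalf : Uq C h := mk C h (Free.gen Gen.gammaHalf)

def d : Uq C h := mk C h (Free.gen Gen.d)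

def k (i : ι) : Uq C h := mk C h (Free.gen (Gen.k i))

def kInv (i : ι) : Uq C h := mk C h (Free.gen (Gen.kInv i))

def a (i : ι) (n : ℤ) : Uq C h := mk C h (Free.a i n)

def x (ε : ℤˣ) (i : ι) (n : ℤ) : Uq C h := mk C h (Free.x ε i n)

end Uq

/-! ## Modules of level `k` -/

section Modules

variable {ι : Type*} [Fintype ι] (C : CartanDatum ι) (h : ℂ) (κ : ℚ)
variable (V : Type*) [AddCommGroup V] [Module ℂ V] [Module (Uq C h) V] [IsScalarTower ℂ (Uq C h) V]

/-- The homogeneous subspace `V_c = {v | d v = c v}`. -/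
def homogeneous (c : ℂ) : Submodule ℂ V :=
  Module.End.eigenspace (Algebra.lsmul ℂ ℂ V (Uq.d C h)) c

/-- Modules of level `κ` (`γ = q^c` acts as `q^κ`, and accordingly `γ^{1/2} = q^{c/2}` as `q^{κ/2}`),
spanned by their homogeneous subspaces, with degrees bounded above on each coset of `ℤ`. Weight
spaces may be infinite-dimensional. -/
structure IsLevelModule : Prop where
  level : ∀ v : V, Uq.gammaHalf C h • v = qpow h (κ / 2) • v
  graded : ⨆ c : ℂ, homogeneous C h V c = ⊤
  bounded : ∀ c : ℂ, ∃ n₀ : ℕ, ∀ n : ℕ, n₀ < n → homogeneous C h V (c + n) = ⊥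

/-! ## `Z`-vertex operators -/

/-- `E_-^±(α_i, z) = exp (∓ ∑_{n ≥ 1} q^{∓κn/2} / [κn] a_i(-n) z^n)`, a power series in `z`. -/
def EMinus (ε : ℤˣ) (i : ι) : (Uq C h)⟦X⟧ :=
  formalExp (PowerSeries.mk fun n : ℕ =>
    (-((ε : ℤ) : ℂ) * (qpow h (-(((ε : ℤ) : ℚ) * κ * n / 2)) / qnum h (κ * n))) •
      Uq.a C h i (-(n : ℤ)))

/-- `E_+^±(α_i, z) = exp (± ∑_{n ≥ 1} q^{∓κn/2} / [κn] a_i(n) z^{-n})`, a power series in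
`z^{-1}`. -/
def EPlus (ε : ℤˣ) (i : ι) : (Uq C h)⟦X⟧ :=
  formalExp (PowerSeries.mk fun n : ℕ =>
    (((ε : ℤ) : ℂ) * (qpow h (-(((ε : ℤ) : ℚ) * κ * n / 2)) / qnum h (κ * n))) •
      Uq.a C h i (n : ℤ))

variable {V}

/-- The terms whose sum over `(r, s)` is the coefficient of `z^{-n}` in
`E_-^±(α_i, z) x_i^±(z) E_+^±(α_i, z) v`, where `x_i^±(z) = ∑ x_i^±(n) z^{-n}`. -/
def zTerm (ε : ℤˣ) (i : ι) (n : ℤ) (v : V) (p : ℕ × ℕ) : V :=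
  PowerSeries.coeff p.1 (EMinus C h κ ε i) •
    Uq.x C h ε i (n + p.1 - p.2) • PowerSeries.coeff p.2 (EPlus C h κ ε i) • v

/-- `Z ε i n` are the components of `Z^±(α_i, z) = E_-^±(α_i, z) x_i^±(z) E_+^±(α_i, z)`, i.e.
`Z^±(α_i, z) = ∑ Z^±_i(n) z^{-n}`: on each vector the product is a sum with finitely many nonzero
terms in every degree, and `Z ε i n` is that sum. -/
def IsZOperator (Z : ℤˣ → ι → ℤ → Module.End ℂ V) : Prop :=
  ∀ (ε : ℤˣ) (i : ι) (n : ℤ) (v : V),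
    (Function.support (zTerm C h κ ε i n v)).Finite ∧
      Z ε i n v = ∑ᶠ p : ℕ × ℕ, zTerm C h κ ε i n v p

end Modules

/-! ## Formal series in `z^{±1}`, `w^{±1}`

A function `F : ℤ → ℤ → V` stands for the formal series `∑ F a b z^a w^b`. -/

section Series

variable {V : Type*} [AddCommGroup V] [Module ℂ V]

/-- `(c₁ z - c₂ w) F(z, w)`. -/
def mulLinear (c₁ c₂ : ℂ) (F : ℤ → ℤ → V) (a b : ℤ) : V :=
  c₁ • F (a - 1) b - c₂ • F a (b - 1)

/-- `P(w/z) F(z, w)`. -/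
def mulSeriesWZ (P : ℂ⟦X⟧) (F : ℤ → ℤ → V) (a b : ℤ) : V :=
  ∑ᶠ r : ℕ, PowerSeries.coeff r P • F (a + r) (b - r)

/-- `P(z/w) F(z, w)`. -/
def mulSeriesZW (P : ℂ⟦X⟧) (F : ℤ → ℤ → V) (a b : ℤ) : V :=
  ∑ᶠ r : ℕ, PowerSeries.coeff r P • F (a - r) (b + r)

/-- The coefficients of `δ(c z/w) = ∑_{n ∈ ℤ} c^n z^n w^{-n}`. -/
def delta (c : ℂ) (a b : ℤ) : ℂ := if b = -a then c ^ a else 0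

/-- `X(z) Y(w) v` for `X(z) = ∑ X(n) z^{-n}`, `Y(w) = ∑ Y(n) w^{-n}`. -/
def prodZW (X Y : ℤ → Module.End ℂ V) (v : V) (a b : ℤ) : V := X (-a) (Y (-b) v)

/-- `Y(w) X(z) v` for `X(z) = ∑ X(n) z^{-n}`, `Y(w) = ∑ Y(n) w^{-n}`. -/
def prodWZ (Y X : ℤ → Module.End ℂ V) (v : V) (a b : ℤ) : V := Y (-b) (X (-a) v)

/-- Operators `Z^±_i(n)` and `K_i^{±1}` on `V` satisfying the defining relations of the homogeneous
quantum `Z`-algebra of level `κ`, for `Z^±(α_i, z) = ∑ Z^±_i(n) z^{-n}`. By the first condition all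
sums in the relations, applied to a vector, have finitely many nonzero terms in every degree. -/
structure QuantumZRelations {ι : Type*} [Fintype ι] [DecidableEq ι] (C : CartanDatum ι) (h : ℂ)
    (κ : ℚ) (K KInv : ι → Module.End ℂ V) (Z : ℤˣ → ι → ℤ → Module.End ℂ V) : Prop where
  truncated : ∀ (ε : ℤˣ) (i : ι) (v : V), ∃ N : ℤ, ∀ n : ℤ, N < n → Z ε i n v = 0
  /-- `(1 - q^{∓κ} w/z)^{(α_i|α_j)/κ} (z - q^{±(α_i|α_j)} w) Z^±(α_i, z) Z^±(α_j, w)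
    = (1 - q^{∓κ} z/w)^{(α_i|α_j)/κ} (q^{±(α_i|α_j)} z - w) Z^±(α_j, w) Z^±(α_i, z)` -/
  same_sign : ∀ (ε : ℤˣ) (i j : ι) (v : V),
    mulSeriesWZ
        (PowerSeries.rescale (qpow h (-(((ε : ℤ) : ℚ) * κ))) (qPochhammerPow h κ (C.form i j)))
        (mulLinear 1 (qpow h (((ε : ℤ) : ℚ) * C.form i j)) (prodZW (Z ε i) (Z ε j) v))
      = mulSeriesZW
        (PowerSeries.rescale (qpow h (-(((ε : ℤ) : ℚ) * κ))) (qPochhammerPow h κ (C.form i j)))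
        (mulLinear (qpow h (((ε : ℤ) : ℚ) * C.form i j)) 1 (prodWZ (Z ε j) (Z ε i) v))
  /-- `(1 - w/z)^{-(α_i|α_j)/κ} Z^+(α_i, z) Z^-(α_j, w)
      - (1 - z/w)^{-(α_i|α_j)/κ} Z^-(α_j, w) Z^+(α_i, z)
    = δ_{ij} / (q_i - q_i^{-1}) (K_i δ(q^{-κ} z/w) - K_i^{-1} δ(q^κ z/w))` -/
  mixed_sign : ∀ (i j : ι) (v : V) (a b : ℤ),
    mulSeriesWZ (qPochhammerPow h κ (-C.form i j)) (prodZW (Z 1 i) (Z (-1) j) v) a b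
        - mulSeriesZW (qPochhammerPow h κ (-C.form i j)) (prodWZ (Z (-1) j) (Z 1 i) v) a b
      = if i = j then
          (qpow h (C.d i) - qpow h (-C.d i))⁻¹ •
            (delta (qpow h (-κ)) a b • K i v - delta (qpow h κ) a b • KInv i v)
        else 0

end Series

end QuantumZ

end

noncomputable section

namespace QuantumZ

/-! ## Sums over antidiagonals -/

section Antidiagonal

open Finset

variable {M : Type*} [AddCommMonoid M]

/-! The factors `E_±` are normalized so that every positive mode `a_i(m)` commutes with every
`Z_j^±(n)`: the bracket of `a_i(m)` with `E_-` is opposite to its bracket with `x_j^±`, because the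
factor `[κm]` in the Heisenberg relation cancels the denominator `[κm]` in the exponent
(`IsLevelModule.commute_aOp_op`). Hence in `Z_i(z) Z_j(w)` the factor `E_+(z)` passes through all of
`Z_j(w)` at no cost. The only contraction comes from moving `E_-(w)` to the left of `x_i(z)`. As
`[a_j(-n), x_i(p)]` is a multiple of `x_i(p-n)`, this contraction is a scalar series in `w/z`, the
exponential computed by `coeff_formalExp_mul_field`. It equals `(1-q^{∓κ}w/z)^{(α_i|α_j)/κ}` for
equal signs and `(1-w/z)^{-(α_i|α_j)/κ}` for opposite ones.

Multiplied by that series, the product becomes the dressing `E_-(z) E_-(w) ⋯ E_+(w) E_+(z)` of the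
bare product `x_i(z) x_j(w)`. The opposite order gives the same dressing of `x_j(w) x_i(z)`, since
the `E_-` commute among themselves and so do the `E_+`. Dressing is linear, so every relation
between the bare products carries over.

For equal signs this is the quadratic Drinfeld relation. For opposite signs the bare commutator is a
combination of `δ ψ_i` and `δ φ_i`. On the support of the first delta function the two `E_-` cancel
each other, and the two `E_+` cancel the exponential in `ψ_i`; on the support of the second the
roles are exchanged. Only `k_i^{±1}` survives (`DressedField.eventually_normalSum_psi`,
`DressedField.eventually_normalSum_phi`).

Convergence is handled by degree: each vector is annihilated by all operators of sufficiently large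
degree with respect to `d`. Each coefficient is therefore a finite sum over a box of any large
enough size `B`, and the identities are compared at a common `B`. -/

theorem sum_antidiagonal_assoc (n : ℕ) (F : ℕ → ℕ → ℕ → M) :
    ∑ p ∈ antidiagonal n, ∑ q ∈ antidiagonal p.2, F p.1 q.1 q.2
      = ∑ p ∈ antidiagonal n, ∑ q ∈ antidiagonal p.1, F q.1 q.2 p.2 := by
  simp only [Finset.sum_sigma']
  refine Finset.sum_nbij' (fun x => ⟨(x.1.1 + x.2.1, x.2.2), (x.1.1, x.2.1)⟩)
    (fun x => ⟨(x.2.1, x.2.2 + x.1.2), (x.2.2, x.1.2)⟩) ?_ ?_ ?_ ?_ ?_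
  all_goals
    rintro ⟨⟨a, b⟩, ⟨c, e⟩⟩
    simp only [mem_sigma, HasAntidiagonal.mem_antidiagonal]
    rintro ⟨rfl, rfl⟩
    simp [add_assoc]

theorem sum_antidiagonal_left_comm (n : ℕ) (F : ℕ → ℕ → ℕ → M) :
    ∑ p ∈ antidiagonal n, ∑ q ∈ antidiagonal p.2, F p.1 q.1 q.2
      = ∑ p ∈ antidiagonal n, ∑ q ∈ antidiagonal p.2, F q.1 p.1 q.2 := by
  rw [sum_antidiagonal_assoc, sum_antidiagonal_assoc n (fun a b c => F b a c)]
  refine Finset.sum_congr rfl fun p _ => ?_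
  rw [← Finset.Nat.sum_antidiagonal_swap]
  rfl

/-- A double sum whose terms vanish beyond the triangle is a sum over antidiagonals. -/
theorem sum_range_sum_antidiagonal (B : ℕ) (F : ℕ → ℕ → M)
    (hF : ∀ u t, B ≤ u + t → F u t = 0) :
    ∑ r ∈ range B, ∑ p ∈ antidiagonal r, F p.1 p.2 = ∑ u ∈ range B, ∑ t ∈ range B, F u t := by
  rw [← Finset.sum_product', Finset.sum_sigma']
  symm
  have hsub : ((range B ×ˢ range B).filter fun p => p.1 + p.2 < B) ⊆ range B ×ˢ range B :=
    Finset.filter_subset _ _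
  rw [← Finset.sum_subset hsub]
  · refine Finset.sum_nbij' (fun p => ⟨p.1 + p.2, p⟩) (fun x => x.2) ?_ ?_ ?_ ?_ ?_
    · rintro ⟨a, b⟩
      simp
    · rintro ⟨a, ⟨b, c⟩⟩
      simp only [mem_sigma, HasAntidiagonal.mem_antidiagonal, mem_filter, mem_product, mem_range]
      omega
    · simp
    · rintro ⟨a, ⟨b, c⟩⟩
      simp only [mem_sigma, HasAntidiagonal.mem_antidiagonal]
      rintro ⟨_, rfl⟩
      rfl
    · simp
  · rintro ⟨a, b⟩ hab hn
    refine hF a b ?_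
    simp only [mem_filter, not_and, not_lt] at hn
    exact hn hab

end Antidiagonal

/-! ## Formal exponentials -/

section FormalExp

open Finset

variable {A : Type*} [Ring A]

/-- The coefficients of `f` commute with those of `g`. -/
def CoeffCommute (f g : A⟦X⟧) : Prop := ∀ m n, Commute (coeff m f) (coeff n g)

theorem CoeffCommute.symm {f g : A⟦X⟧} (hfg : CoeffCommute f g) : CoeffCommute g f :=
  fun m n => (hfg n m).symm

theorem CoeffCommute.commute {f g : A⟦X⟧} (hfg : CoeffCommute f g) : Commute f g := by
  ext n
  rw [coeff_mul, coeff_mul, ← Finset.Nat.sum_antidiagonal_swap]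
  exact Finset.sum_congr rfl fun p _ => (hfg _ _)

theorem CoeffCommute.mul_right {f g k : A⟦X⟧} (hg : CoeffCommute f g) (hk : CoeffCommute f k) :
    CoeffCommute f (g * k) := by
  intro m n
  rw [coeff_mul]
  exact Commute.sum_right _ _ _ fun p _ => (hg _ _).mul_right (hk _ _)

theorem CoeffCommute.pow_right {f g : A⟦X⟧} (hg : CoeffCommute f g) (r : ℕ) :
    CoeffCommute f (g ^ r) := by
  induction r with
  | zero =>
    intro m n
    rw [pow_zero, coeff_one]
    split_ifs
    · exact Commute.one_right _
    · exact Commute.zero_right _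
  | succ r ih =>
    rw [pow_succ]
    exact ih.mul_right hg

theorem coeff_pow_eq_zero {f : A⟦X⟧} (hf : coeff 0 f = 0) :
    ∀ (r n : ℕ), n < r → coeff n (f ^ r) = 0
  | 0, n, h => absurd h (Nat.not_lt_zero n)
  | r + 1, n, h => by
    rw [pow_succ, coeff_mul]
    refine Finset.sum_eq_zero fun p hp => ?_
    rw [HasAntidiagonal.mem_antidiagonal] at hp
    rcases Nat.eq_zero_or_pos p.2 with h2 | h2
    · rw [h2, hf, mul_zero]
    · rw [coeff_pow_eq_zero hf r p.1 (by omega), zero_mul]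

variable [Algebra ℂ A]

theorem CoeffCommute.formalExp_right {f g : A⟦X⟧} (hg : CoeffCommute f g) :
    CoeffCommute f (formalExp g) := by
  intro m n
  rw [formalExp, coeff_mk]
  exact Commute.sum_right _ _ _ fun r _ => (hg.pow_right r m n).smul_right _

theorem CoeffCommute.formalExp {f g : A⟦X⟧} (hg : CoeffCommute f g) :
    CoeffCommute (formalExp f) (formalExp g) :=
  hg.formalExp_right.symm.formalExp_right.symm

theorem commute_coeff_formalExp {y : A} {f : A⟦X⟧} (hy : ∀ n, Commute y (coeff n f)) (n : ℕ) :
    Commute y (coeff n (formalExp f)) := by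
  have : CoeffCommute (PowerSeries.C y) f := by
    intro m n
    rw [coeff_C]
    split_ifs
    · exact hy n
    · exact Commute.zero_left _
  simpa using this.formalExp_right 0 n

theorem coeff_complex_smul (c : ℂ) (n : ℕ) (f : A⟦X⟧) : coeff n (c • f) = c • coeff n f :=
  rfl

/-- `X d/dX`. -/
def euler (f : A⟦X⟧) : A⟦X⟧ := PowerSeries.mk fun n => (n : ℂ) • coeff n f

@[simp]
theorem coeff_euler (n : ℕ) (f : A⟦X⟧) : coeff n (euler f) = (n : ℂ) • coeff n f := by
  rw [euler, coeff_mk]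

theorem euler_mul (f g : A⟦X⟧) : euler (f * g) = euler f * g + f * euler g := by
  ext n
  simp only [coeff_euler, coeff_mul, map_add, Finset.smul_sum, ← Finset.sum_add_distrib]
  refine Finset.sum_congr rfl fun p hp => ?_
  rw [← HasAntidiagonal.mem_antidiagonal.mp hp, smul_mul_assoc, mul_smul_comm, ← add_smul]
  push_cast
  rfl

theorem euler_pow {f : A⟦X⟧} (hf : CoeffCommute f f) (r : ℕ) :
    euler (f ^ (r + 1)) = ((r + 1 : ℕ) : ℂ) • (euler f * f ^ r) := by
  have hc : Commute f (euler f) := by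
    refine CoeffCommute.commute fun m n => ?_
    rw [coeff_euler]
    exact (hf m n).smul_right _
  induction r with
  | zero => simp
  | succ r ih =>
    rw [pow_succ' f (r + 1), euler_mul, ih, mul_smul_comm, ← mul_assoc f, hc.eq, mul_assoc,
      ← pow_succ']
    push_cast
    module

/-- The cutoff built into `formalExp` depends on the degree; since high powers of `f` do not
contribute, a single cutoff serves several degrees at once. -/
theorem coeff_formalExp_of_lt {f : A⟦X⟧} (hf : coeff 0 f = 0) {n N : ℕ} (hn : n < N) :
    coeff n (formalExp f) = ∑ r ∈ range N, ((r.factorial : ℂ)⁻¹) • coeff n (f ^ r) := by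
  rw [formalExp, coeff_mk]
  refine Finset.sum_subset (by simpa using hn) fun r _ hr => ?_
  rw [coeff_pow_eq_zero hf r n (by simpa using hr), smul_zero]

@[simp]
theorem coeff_zero_formalExp (f : A⟦X⟧) : coeff 0 (formalExp f) = 1 := by
  simp [formalExp]

/-- Termwise, the derivative of `f^(r+1)/(r+1)!` is `f' f^r/r!`; commuting coefficients are needed
so that `f'` can be moved to the front. -/
theorem euler_formalExp {f : A⟦X⟧} (h0 : coeff 0 f = 0) (hf : CoeffCommute f f) :
    euler (formalExp f) = euler f * formalExp f := by
  ext n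
  rw [coeff_euler, coeff_formalExp_of_lt h0 (Nat.lt_succ_self n), Finset.sum_range_succ', coeff_mul]
  have hzero : (n : ℂ) • coeff n (f ^ 0) = 0 := by
    rw [pow_zero, coeff_one]
    split_ifs with h
    · simp [h]
    · simp
  rw [smul_add, smul_comm (n : ℂ) _ (coeff n (f ^ 0)), hzero, smul_zero, add_zero, Finset.smul_sum]
  have hterm : ∀ r ∈ range n, (n : ℂ) • (((r + 1).factorial : ℂ)⁻¹) • coeff n (f ^ (r + 1))
      = ∑ p ∈ antidiagonal n, coeff p.1 (euler f) * ((r.factorial : ℂ)⁻¹ • coeff p.2 (f ^ r)) := by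
    intro r _
    rw [smul_comm, ← coeff_euler, euler_pow hf, coeff_complex_smul, coeff_mul, smul_smul,
      Finset.smul_sum]
    refine Finset.sum_congr rfl fun p _ => ?_
    rw [mul_smul_comm, Nat.factorial_succ]
    congr 1
    have h1 : ((r + 1 : ℕ) : ℂ) ≠ 0 := Nat.cast_ne_zero.mpr (Nat.succ_ne_zero r)
    have h2 : (r.factorial : ℂ) ≠ 0 := Nat.cast_ne_zero.mpr (Nat.factorial_ne_zero r)
    push_cast at h1 ⊢
    field_simp
  rw [Finset.sum_congr rfl hterm, Finset.sum_comm]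
  refine Finset.sum_congr rfl fun p hp => ?_
  rw [HasAntidiagonal.mem_antidiagonal] at hp
  -- The derivative has no constant term, so only `p.2 < n` matters, and there the cutoff `n` is
  -- long enough.
  rcases Nat.eq_zero_or_pos p.1 with h1 | h1
  · simp [h1]
  · rw [coeff_formalExp_of_lt h0 (show p.2 < n by omega), Finset.mul_sum]

/-- The recursion that determines the coefficients of an exponential. -/
theorem natCast_smul_coeff_formalExp {f : A⟦X⟧} (h0 : coeff 0 f = 0) (hf : CoeffCommute f f)
    (n : ℕ) :
    (n : ℂ) • coeff n (formalExp f)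
      = ∑ p ∈ antidiagonal n, (p.1 : ℂ) • (coeff p.1 f * coeff p.2 (formalExp f)) := by
  rw [← coeff_euler, euler_formalExp h0 hf, coeff_mul]
  exact Finset.sum_congr rfl fun p _ => by rw [coeff_euler, smul_mul_assoc]

theorem natCast_smul_cancel {n : ℕ} (hn : n ≠ 0) {x y : A} (hxy : (n : ℂ) • x = (n : ℂ) • y) :
    x = y :=
  smul_right_injective A (Nat.cast_ne_zero.mpr hn) hxy

/-- The equation `g' = f' g` determines `n` times the `n`-th coefficient of `g` from the lower ones,
since `f'` starts in degree one. This uniqueness replaces binomial expansions in the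
multiplicativity of the exponential. -/
theorem eq_formalExp {f g : A⟦X⟧} (h0 : coeff 0 f = 0) (hf : CoeffCommute f f)
    (hg0 : coeff 0 g = 1) (hg : euler g = euler f * g) : g = formalExp f := by
  ext n
  induction n using Nat.strong_induction_on with
  | _ n ih =>
    rcases Nat.eq_zero_or_pos n with rfl | hn
    · simp [hg0]
    · refine natCast_smul_cancel hn.ne' ?_
      rw [← coeff_euler, ← coeff_euler, hg, euler_formalExp h0 hf, coeff_mul, coeff_mul]
      refine Finset.sum_congr rfl fun p hp => ?_
      rw [HasAntidiagonal.mem_antidiagonal] at hp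
      rcases Nat.eq_zero_or_pos p.1 with h1 | h1
      · simp [h1]
      · rw [ih p.2 (by omega)]

theorem formalExp_add {f g : A⟦X⟧} (hf0 : coeff 0 f = 0) (hg0 : coeff 0 g = 0)
    (hf : CoeffCommute f f) (hg : CoeffCommute g g) (hfg : CoeffCommute f g) :
    formalExp (f + g) = formalExp f * formalExp g := by
  symm
  apply eq_formalExp
  · rw [map_add, hf0, hg0, add_zero]
  · intro m n
    simp only [map_add]
    exact ((hf m n).add_right (hfg m n)).add_left ((hfg.symm m n).add_right (hg m n))
  · simp [coeff_mul]
  · have hadd : euler (f + g) = euler f + euler g := by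
      ext n
      simp
    have hc : Commute (formalExp f) (euler g) := by
      refine CoeffCommute.commute fun m n => ?_
      rw [coeff_euler]
      exact (hfg.symm.formalExp_right.symm m n).smul_right _
    rw [euler_mul, euler_formalExp hf0 hf, euler_formalExp hg0 hg, hadd, add_mul, ← mul_assoc
      (formalExp f), hc.eq]
    simp only [mul_assoc]

@[simp]
theorem formalExp_zero : formalExp (0 : A⟦X⟧) = 1 := by
  symm
  apply eq_formalExp
  · simp
  · intro m n
    simp
  · simp
  · ext n
    simp only [coeff_euler, coeff_one]
    split_ifs with h
    · simp [h]
    · simp [euler]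

theorem coeff_formalExp_map {A' : Type*} [Ring A'] [Algebra ℂ A'] (φ : A →ₐ[ℂ] A') (f : A⟦X⟧)
    (n : ℕ) :
    φ (coeff n (formalExp f)) = coeff n (formalExp (PowerSeries.map (φ : A →+* A') f)) := by
  simp only [formalExp, coeff_mk, map_sum, map_smul, ← map_pow, coeff_map]
  rfl

/-- `f(cX)`. -/
def scaleX (c : ℂ) (f : A⟦X⟧) : A⟦X⟧ := PowerSeries.mk fun n => c ^ n • coeff n f

@[simp]
theorem coeff_scaleX (c : ℂ) (f : A⟦X⟧) (n : ℕ) : coeff n (scaleX c f) = c ^ n • coeff n f := by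
  rw [scaleX, coeff_mk]

theorem scaleX_mul (c : ℂ) (f g : A⟦X⟧) : scaleX c (f * g) = scaleX c f * scaleX c g := by
  ext n
  simp only [coeff_scaleX, coeff_mul, Finset.smul_sum]
  refine Finset.sum_congr rfl fun p hp => ?_
  rw [← HasAntidiagonal.mem_antidiagonal.mp hp, pow_add, smul_mul_smul_comm]

theorem scaleX_pow (c : ℂ) (f : A⟦X⟧) (r : ℕ) : scaleX c (f ^ r) = scaleX c f ^ r := by
  induction r with
  | zero =>
    ext n
    simp only [pow_zero, coeff_scaleX, coeff_one]
    split_ifs with h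
    · simp [h]
    · simp
  | succ r ih => rw [pow_succ, scaleX_mul, ih, pow_succ]

theorem scaleX_formalExp (c : ℂ) (f : A⟦X⟧) : scaleX c (formalExp f) = formalExp (scaleX c f) := by
  ext n
  simp only [coeff_scaleX, formalExp, coeff_mk, Finset.smul_sum, ← scaleX_pow]
  exact Finset.sum_congr rfl fun r _ => smul_comm _ _ _

theorem rescale_formalExp (c : ℂ) (f : ℂ⟦X⟧) :
    PowerSeries.rescale c (formalExp f) = formalExp (PowerSeries.rescale c f) := by
  have : ∀ g : ℂ⟦X⟧, PowerSeries.rescale c g = scaleX c g := fun g => by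
    ext n
    simp
  rw [this, this, scaleX_formalExp]

/-- If `[f_j, x(p)] = λ_j x(p - j)` for all `j`, then
`exp(f)(w) x(z) = exp(λ)(w/z) x(z) exp(f)(w)`. -/
theorem coeff_formalExp_mul_field {f : A⟦X⟧} (h0 : coeff 0 f = 0) (hf : CoeffCommute f f)
    {l : ℂ⟦X⟧} (hl : coeff 0 l = 0) {x : ℤ → A}
    (hx : ∀ (j : ℕ) (p : ℤ), coeff j f * x p = x p * coeff j f + coeff j l • x (p - j))
    (r : ℕ) (p : ℤ) :
    coeff r (formalExp f) * x p
      = ∑ y ∈ antidiagonal r,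
          coeff y.1 (formalExp l) • (x (p - y.1) * coeff y.2 (formalExp f)) := by
  have hl' : CoeffCommute l l := fun _ _ => Commute.all _ _
  induction r using Nat.strong_induction_on generalizing p with
  | _ r ih =>
    rcases Nat.eq_zero_or_pos r with rfl | hr
    · simp
    refine natCast_smul_cancel hr.ne' ?_
    set E := formalExp f
    set P := formalExp l
    -- Each summand `f_a E_b` of the recursion for `E_r` is carried past `x`: first `E_b` by
    -- induction, then `f_a` by the bracket. For `a = 0` induction is unavailable, but the weight is
    -- zero.
    have step : ∀ y ∈ antidiagonal r, ((y.1 : ℂ) • (coeff y.1 f * coeff y.2 E)) * x p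
        = ∑ y' ∈ antidiagonal y.2, ((y.1 : ℂ) • coeff y'.1 P •
            (x (p - y'.1) * (coeff y.1 f * coeff y'.2 E))
          + ((y.1 : ℂ) • coeff y.1 l • coeff y'.1 P •
            (x (p - ((y.1 + y'.1 : ℕ) : ℤ)) * coeff y'.2 E))) := by
      intro y hy
      rw [HasAntidiagonal.mem_antidiagonal] at hy
      rcases Nat.eq_zero_or_pos y.1 with h1 | h1
      · simp [h1]
      rw [smul_mul_assoc, mul_assoc, ih y.2 (by omega), Finset.mul_sum, Finset.smul_sum]
      refine Finset.sum_congr rfl fun y' _ => ?_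
      rw [mul_smul_comm, ← mul_assoc, hx, add_mul, smul_add, smul_add, mul_assoc, smul_mul_assoc,
        smul_comm (coeff y'.1 P) (coeff y.1 l)]
      congr 6
      push_cast
      ring
    rw [← smul_mul_assoc, natCast_smul_coeff_formalExp h0 hf, Finset.sum_mul,
      Finset.sum_congr rfl step]
    simp only [Finset.sum_add_distrib]
    rw [sum_antidiagonal_left_comm r (fun a b c => (a : ℂ) • coeff b P •
      (x (p - b) * (coeff a f * coeff c E))), sum_antidiagonal_assoc r (fun a b c =>
      (a : ℂ) • coeff a l • coeff b P • (x (p - ((a + b : ℕ) : ℤ)) * coeff c E)),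
      ← Finset.sum_add_distrib, Finset.smul_sum]
    refine Finset.sum_congr rfl fun y hy => ?_
    -- The recursion for `exp f` collapses the first family to weight `y.2`, and that for `exp l`
    -- collapses the bracket terms to weight `y.1`; the weights add up to `r`, which cancels the
    -- factor on the left.
    have e1 : ∑ q ∈ antidiagonal y.2, (q.1 : ℂ) • coeff y.1 P •
        (x (p - y.1) * (coeff q.1 f * coeff q.2 E))
        = (y.2 : ℂ) • coeff y.1 P • (x (p - y.1) * coeff y.2 E) := by
      rw [smul_comm, ← mul_smul_comm (y.2 : ℂ), natCast_smul_coeff_formalExp h0 hf, Finset.mul_sum,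
        Finset.smul_sum]
      exact Finset.sum_congr rfl fun q _ => by rw [mul_smul_comm, smul_comm]
    have e2 : ∑ q ∈ antidiagonal y.1, (q.1 : ℂ) • coeff q.1 l • coeff q.2 P •
        (x (p - ((q.1 + q.2 : ℕ) : ℤ)) * coeff y.2 E)
        = (y.1 : ℂ) • coeff y.1 P • (x (p - y.1) * coeff y.2 E) := by
      rw [smul_smul, ← smul_eq_mul (y.1 : ℂ), natCast_smul_coeff_formalExp hl hl', Finset.sum_smul]
      refine Finset.sum_congr rfl fun q hq => ?_
      rw [HasAntidiagonal.mem_antidiagonal.mp hq, smul_smul, smul_smul, smul_eq_mul, mul_assoc]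
    rw [e1, e2, ← add_smul, ← HasAntidiagonal.mem_antidiagonal.mp hy, add_comm (y.2 : ℂ)]
    push_cast
    rfl

/-- If `[y, f_j] = μ_j` is scalar for all `j`, then `[y, exp f] = μ exp f`. -/
theorem mul_coeff_formalExp_of_bracket {f : A⟦X⟧} (h0 : coeff 0 f = 0) (hf : CoeffCommute f f)
    {y : A} {μ : ℕ → ℂ} (hy : ∀ j, y * coeff j f = coeff j f * y + μ j • 1) (r : ℕ) :
    y * coeff r (formalExp f)
      = coeff r (formalExp f) * y
        + ∑ p ∈ antidiagonal r, μ p.1 • coeff p.2 (formalExp f) := by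
  induction r using Nat.strong_induction_on with
  | _ r ih =>
    rcases Nat.eq_zero_or_pos r with rfl | hr
    · have := hy 0
      rw [h0, mul_zero, zero_mul, zero_add] at this
      simp [← this]
    refine natCast_smul_cancel hr.ne' ?_
    set E := formalExp f
    have step : ∀ p ∈ antidiagonal r, y * ((p.1 : ℂ) • (coeff p.1 f * coeff p.2 E))
        = ((p.1 : ℂ) • (coeff p.1 f * coeff p.2 E)) * y + (p.1 : ℂ) • μ p.1 • coeff p.2 E
          + ∑ q ∈ antidiagonal p.2, (p.1 : ℂ) • μ q.1 • (coeff p.1 f * coeff q.2 E) := by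
      intro p hp
      rw [HasAntidiagonal.mem_antidiagonal] at hp
      rcases Nat.eq_zero_or_pos p.1 with h1 | h1
      · simp [h1]
      rw [mul_smul_comm, ← mul_assoc, hy, add_mul, mul_assoc, ih p.2 (by omega), mul_add,
        ← mul_assoc, Finset.mul_sum, smul_mul_assoc, one_mul, smul_add, smul_add, smul_mul_assoc,
        Finset.smul_sum, add_right_comm]
      simp only [mul_smul_comm]
    rw [← mul_smul_comm, natCast_smul_coeff_formalExp h0 hf, Finset.mul_sum,
      Finset.sum_congr rfl step, Finset.sum_add_distrib, Finset.sum_add_distrib, ← Finset.sum_mul,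
      ← natCast_smul_coeff_formalExp h0 hf, smul_mul_assoc, smul_add, add_assoc,
      sum_antidiagonal_left_comm r (fun a b c => (a : ℂ) • μ b • (coeff a f * coeff c E)),
      ← Finset.sum_add_distrib, Finset.smul_sum]
    congr 1
    refine Finset.sum_congr rfl fun p hp => ?_
    -- Brackets that hit the leading factor `f_a` already carry weight `p.1`; those that hit `E`
    -- collapse to weight `p.2`, for a total of `r`.
    have e1 : ∑ q ∈ antidiagonal p.2, (q.1 : ℂ) • μ p.1 • (coeff q.1 f * coeff q.2 E)
        = (p.2 : ℂ) • μ p.1 • coeff p.2 E := by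
      rw [smul_comm, natCast_smul_coeff_formalExp h0 hf, Finset.smul_sum]
      exact Finset.sum_congr rfl fun q _ => smul_comm _ _ _
    rw [e1, ← add_smul, ← HasAntidiagonal.mem_antidiagonal.mp hp]
    push_cast
    rfl

end FormalExp

/-! ## Operators of given degree -/

section Degree

open Finset

variable {V : Type*} [AddCommGroup V] [Module ℂ V] (d : Module.End ℂ V)

/-- The operators `T` with `[d, T] = n T`. -/
def Deg (n : ℤ) : Submodule ℂ (Module.End ℂ V) where
  carrier := {T | d * T = T * d + (n : ℂ) • T}
  add_mem' {S T} hS hT := by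
    simp only [Set.mem_ofPred_eq] at *
    rw [mul_add, add_mul, hS, hT]
    module
  zero_mem' := by simp
  smul_mem' c T hT := by
    simp only [Set.mem_ofPred_eq] at *
    rw [mul_smul_comm, hT, smul_mul_assoc]
    module

variable {d}

theorem mem_Deg {n : ℤ} {T : Module.End ℂ V} : T ∈ Deg d n ↔ d * T = T * d + (n : ℂ) • T :=
  Iff.rfl

theorem mul_mem_Deg {m n : ℤ} {S T : Module.End ℂ V} (hS : S ∈ Deg d m) (hT : T ∈ Deg d n) :
    S * T ∈ Deg d (m + n) := by
  rw [mem_Deg] at *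
  rw [← mul_assoc, hS, add_mul, mul_assoc, hT, mul_add, smul_mul_assoc, mul_smul_comm]
  push_cast
  rw [mul_assoc]
  module

theorem one_mem_Deg : (1 : Module.End ℂ V) ∈ Deg d 0 := by
  simp [mem_Deg]

theorem coeff_pow_mem_Deg {f : (Module.End ℂ V)⟦X⟧} {σ : ℤ}
    (hf : ∀ n : ℕ, coeff n f ∈ Deg d (σ * n)) (r n : ℕ) : coeff n (f ^ r) ∈ Deg d (σ * n) := by
  induction r generalizing n with
  | zero =>
    rw [pow_zero, coeff_one]
    split_ifs with h
    · simpa [h] using one_mem_Deg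
    · exact Submodule.zero_mem _
  | succ r ih =>
    rw [pow_succ, coeff_mul]
    refine Submodule.sum_mem _ fun p hp => ?_
    rw [← HasAntidiagonal.mem_antidiagonal.mp hp, Nat.cast_add, mul_add]
    exact mul_mem_Deg (ih _) (hf _)

theorem coeff_formalExp_mem_Deg {f : (Module.End ℂ V)⟦X⟧} {σ : ℤ}
    (hf : ∀ n : ℕ, coeff n f ∈ Deg d (σ * n)) (n : ℕ) :
    coeff n (formalExp f) ∈ Deg d (σ * n) := by
  rw [formalExp, coeff_mk]
  exact Submodule.sum_mem _ fun r _ => Submodule.smul_mem _ _ (coeff_pow_mem_Deg hf r n)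

variable (d)

/-- All operators of degree above `N` annihilate `v`. -/
def KilledAbove (N : ℤ) (v : V) : Prop := ∀ n : ℤ, N < n → ∀ T ∈ Deg d n, T v = 0

/-- Every vector is annihilated by the operators of large degree. -/
def LocallyBounded : Prop := ∀ v : V, ∃ N : ℤ, KilledAbove d N v

variable {d}

theorem KilledAbove.mono {N N' : ℤ} {v : V} (hv : KilledAbove d N v) (h : N ≤ N') :
    KilledAbove d N' v := fun n hn => hv n (h.trans_lt hn)

theorem KilledAbove.apply {N m : ℤ} {v : V} (hv : KilledAbove d N v) {T : Module.End ℂ V}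
    (hT : T ∈ Deg d m) : KilledAbove d (N - m) (T v) := by
  intro n hn S hS
  exact hv (n + m) (by omega) (S * T) (mul_mem_Deg hS hT)

theorem LocallyBounded.exists_killedAbove₂ (hd : LocallyBounded d) (v w : V) :
    ∃ N, KilledAbove d N v ∧ KilledAbove d N w := by
  obtain ⟨N, hN⟩ := hd v
  obtain ⟨N', hN'⟩ := hd w
  exact ⟨max N N', hN.mono (le_max_left _ _), hN'.mono (le_max_right _ _)⟩

end Degree

/-! ## Dressed fields -/

/-- A field `x(z) = ∑ x(n) z^{-n}` together with series `em(z)` and `ep(z^{-1})`, all homogeneous: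
the data of a product `em(z) x(z) ep(z^{-1})`. -/
structure DressedField {V : Type*} [AddCommGroup V] [Module ℂ V] (d : Module.End ℂ V) where
  em : (Module.End ℂ V)⟦X⟧
  x : ℤ → Module.End ℂ V
  ep : (Module.End ℂ V)⟦X⟧
  em_mem : ∀ r : ℕ, coeff r em ∈ Deg d (-r)
  x_mem : ∀ n : ℤ, x n ∈ Deg d n
  ep_mem : ∀ s : ℕ, coeff s ep ∈ Deg d s

namespace DressedField

open Finset

variable {V : Type*} [AddCommGroup V] [Module ℂ V] {d : Module.End ℂ V}

/-- The terms of the coefficient of `z^{-n}` in `em(z) x(z) ep(z^{-1})`. -/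
def term (F : DressedField d) (n : ℤ) (p : ℕ × ℕ) : Module.End ℂ V :=
  coeff p.1 F.em * (F.x (n + p.1 - p.2) * coeff p.2 F.ep)

variable (F F' : DressedField d)

theorem x_mul_ep_mem (n : ℤ) (s : ℕ) : F.x n * coeff s F.ep ∈ Deg d (n + s) :=
  mul_mem_Deg (F.x_mem _) (F.ep_mem _)

theorem term_mem (n : ℤ) (p : ℕ × ℕ) : F.term n p ∈ Deg d n := by
  have := mul_mem_Deg (F.em_mem p.1) (F.x_mul_ep_mem (n + p.1 - p.2) p.2)
  rwa [show -(p.1 : ℤ) + (n + p.1 - p.2 + p.2) = n by ring] at this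

variable {F}

/-- Two independent cutoffs: `ep_s` raises degree by `s`, and `x · ep_s` together have degree `n +
r`. Either exceeding `N` kills the vector, so both indices are bounded. -/
theorem term_apply_eq_zero {N n : ℤ} {v : V} (hv : KilledAbove d N v) {p : ℕ × ℕ}
    (hp : N < p.2 ∨ N - n < p.1) : F.term n p v = 0 := by
  rcases hp with hp | hp
  · simp only [term, Module.End.mul_apply]
    rw [hv _ hp _ (F.ep_mem _), map_zero, map_zero]
  · rw [term, Module.End.mul_apply,
      hv (n + p.1 - p.2 + p.2) (by omega) _ (F.x_mul_ep_mem _ _), map_zero]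

theorem support_term_subset {N n : ℤ} {v : V} (hv : KilledAbove d N v) {B : ℕ} (h₁ : N < B)
    (h₂ : N - n < B) :
    (Function.support fun p => F.term n p v) ⊆ (range B ×ˢ range B : Finset (ℕ × ℕ)) := by
  intro p hp
  rw [Function.mem_support] at hp
  contrapose! hp
  apply term_apply_eq_zero hv
  simp only [coe_product, coe_range, Set.mem_prod, Set.mem_Iio, not_and_or, not_lt] at hp
  omega

variable (F)

theorem support_term_finite (hd : LocallyBounded d) (n : ℤ) (v : V) :
    (Function.support fun p => F.term n p v).Finite := by
  obtain ⟨N, hN⟩ := hd v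
  exact (Finset.finite_toSet _).subset
    (support_term_subset (B := (max (N + 1) (N - n + 1)).toNat) hN (by omega) (by omega))

/-- The coefficient of `z^{-n}` in `em(z) x(z) ep(z^{-1})`. -/
def op (hd : LocallyBounded d) (n : ℤ) : Module.End ℂ V where
  toFun v := ∑ᶠ p, F.term n p v
  map_add' v w := by
    simp only [map_add]
    exact finsum_add_distrib (F.support_term_finite hd n v) (F.support_term_finite hd n w)
  map_smul' c v := by
    simp only [map_smul, RingHom.id_apply]
    exact (smul_finsum' c (F.support_term_finite hd n v)).symm

theorem op_apply (hd : LocallyBounded d) (n : ℤ) (v : V) :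
    F.op hd n v = ∑ᶠ p, F.term n p v := rfl

/-- The box size is left free above the two bounds, so that different fields and vectors can share
one finite range. -/
theorem op_eq_sum (hd : LocallyBounded d) {N n : ℤ} {v : V} (hv : KilledAbove d N v) {B : ℕ}
    (h₁ : N < B) (h₂ : N - n < B) :
    F.op hd n v = ∑ r ∈ range B, ∑ s ∈ range B, F.term n (r, s) v := by
  rw [op_apply, finsum_eq_sum_of_support_subset _ (support_term_subset hv h₁ h₂),
    Finset.sum_product]

theorem op_mem (hd : LocallyBounded d) (n : ℤ) : F.op hd n ∈ Deg d n := by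
  rw [mem_Deg]
  ext v
  obtain ⟨N, hv, hdv⟩ := hd.exists_killedAbove₂ v (d v)
  obtain ⟨B, h₁, h₂⟩ : ∃ B : ℕ, N < B ∧ N - n < B :=
    ⟨(max (N + 1) (N - n + 1)).toNat, by omega, by omega⟩
  have hterm : ∀ p, d (F.term n p v) = F.term n p (d v) + (n : ℂ) • F.term n p v := fun p =>
    LinearMap.congr_fun (mem_Deg.mp (F.term_mem n p)) v
  simp only [Module.End.mul_apply, LinearMap.add_apply, LinearMap.smul_apply]
  rw [F.op_eq_sum hd hv h₁ h₂, F.op_eq_sum hd hdv h₁ h₂]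
  simp only [map_sum, hterm, Finset.sum_add_distrib, Finset.smul_sum]

/-- An operator of degree `m` whose brackets with `em(z)` and `x(z)` are `∓c z^m` times the series
and which commutes with `ep` commutes with the dressed field. -/
theorem commute_op (hd : LocallyBounded d) {y : Module.End ℂ V} {m : ℕ} {c : ℂ}
    (hem : ∀ r, y * coeff r F.em
      = coeff r F.em * y + ∑ p ∈ antidiagonal r, (if p.1 = m then -c else 0) • coeff p.2 F.em)
    (hx : ∀ p, y * F.x p = F.x p * y + c • F.x (p + m))
    (hep : ∀ s, Commute y (coeff s F.ep)) (n : ℤ) : Commute y (F.op hd n) := by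
  ext v
  obtain ⟨N, hv, hyv⟩ := hd.exists_killedAbove₂ v (y v)
  obtain ⟨B, h₁, h₂, h₃⟩ : ∃ B : ℕ, N < B ∧ N - n < B ∧ m < B :=
    ⟨(max (max (N + 1) (N - n + 1)) (m + 1)).toNat, by omega, by omega, by omega⟩
  simp only [Module.End.mul_apply]
  rw [F.op_eq_sum hd hv h₁ h₂, F.op_eq_sum hd hyv h₁ h₂]
  simp only [map_sum]
  set H : ℕ → ℕ → ℕ → V := fun s u t => (if u = m then -c else 0) •
    coeff t F.em (F.x (n + ((u + t : ℕ) : ℤ) - s) (coeff s F.ep v)) with hH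
  have hterm : ∀ r s, y (F.term n (r, s) v) = F.term n (r, s) (y v)
      + ((∑ p ∈ antidiagonal r, H s p.1 p.2)
        + c • coeff r F.em (F.x (n + m + r - s) (coeff s F.ep v))) := by
    intro r s
    have e : y * F.term n (r, s) = F.term n (r, s) * y
        + ((∑ p ∈ antidiagonal r, (if p.1 = m then -c else 0) • (coeff p.2 F.em *
            (F.x (n + r - s) * coeff s F.ep)))
          + c • (coeff r F.em * (F.x (n + m + r - s) * coeff s F.ep))) := by
      have e₁ : y * (F.x (n + r - s) * coeff s F.ep) = F.x (n + r - s) * coeff s F.ep * y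
          + c • (F.x (n + m + r - s) * coeff s F.ep) := by
        rw [← mul_assoc, hx, add_mul, mul_assoc, (hep s).eq, smul_mul_assoc, mul_assoc,
          show n + r - s + m = n + m + r - (s : ℤ) by ring]
      simp only [term]
      rw [← mul_assoc, hem, add_mul, mul_assoc, e₁, mul_add, mul_smul_comm, Finset.sum_mul]
      simp only [smul_mul_assoc, mul_assoc]
      abel
    have := LinearMap.congr_fun e v
    simp only [Module.End.mul_apply, LinearMap.add_apply, LinearMap.smul_apply,
      LinearMap.sum_apply] at this
    rw [this]
    congr 2
    refine Finset.sum_congr rfl fun p hp => ?_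
    simp only [hH, HasAntidiagonal.mem_antidiagonal.mp hp]
  simp only [hterm, Finset.sum_add_distrib]
  rw [add_eq_left, Finset.sum_comm, Finset.sum_comm (s := range B) (t := range B)
    (f := fun r s => c • coeff r F.em (F.x (n + m + r - s) (coeff s F.ep v))),
    ← Finset.sum_add_distrib]
  refine Finset.sum_eq_zero fun s _ => ?_
  -- For fixed `s` the triangular sum from the bracket with `em` is completed to a square, the added
  -- terms being zero by degree. Only `u = m` survives, and it cancels the bracket with `x` term by
  -- term over the same range.
  rw [sum_range_sum_antidiagonal]
  · rw [Finset.sum_eq_single_of_mem m (Finset.mem_range.mpr h₃), ← Finset.sum_add_distrib]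
    · refine Finset.sum_eq_zero fun t _ => ?_
      simp only [hH, if_true]
      rw [show n + ((m + t : ℕ) : ℤ) - s = n + m + t - s by push_cast; ring]
      module
    · intro u _ hu
      simp [hH, hu]
  · intro u t hut
    simp only [hH]
    rw [← Module.End.mul_apply (F.x _), hv (n + ((u + t : ℕ) : ℤ) - s + s) (by omega) _
      (F.x_mul_ep_mem _ _), map_zero, smul_zero]

/-- The terms, with all four summation indices below `B`, of the coefficient of `z^{-m} w^{-n}` in
`em(z) em'(w) G(z, w) ep'(w^{-1}) ep(z^{-1}) v`, for `G(z, w) = ∑ G(m, n) z^{-m} w^{-n}`. -/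
def normalSum (G : ℤ → ℤ → Module.End ℂ V) (B : ℕ) (m n : ℤ) (v : V) : V :=
  ∑ r ∈ range B, ∑ r' ∈ range B, ∑ s ∈ range B, ∑ s' ∈ range B,
    coeff r F.em (coeff r' F'.em (G (m + r - s) (n + r' - s')
      (coeff s' F'.ep (coeff s F.ep v))))

theorem normalSum_sub (G G' : ℤ → ℤ → Module.End ℂ V) (B : ℕ) (m n : ℤ) (v : V) :
    normalSum F F' (fun m n => G m n - G' m n) B m n v
      = normalSum F F' G B m n v - normalSum F F' G' B m n v := by
  simp only [normalSum, LinearMap.sub_apply, map_sub, Finset.sum_sub_distrib]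

theorem normalSum_smul (c : ℂ) (G : ℤ → ℤ → Module.End ℂ V) (B : ℕ) (m n : ℤ) (v : V) :
    normalSum F F' (fun m n => c • G m n) B m n v = c • normalSum F F' G B m n v := by
  simp only [normalSum, LinearMap.smul_apply, map_smul, Finset.smul_sum]

/-- The box bounds the summation indices and not the modes, so multiplication by `z^a w^b` leaves
the truncation unchanged. -/
theorem normalSum_shift (G : ℤ → ℤ → Module.End ℂ V) (B : ℕ) (a b m n : ℤ) (v : V) :
    normalSum F F' (fun m n => G (m + a) (n + b)) B m n v
      = normalSum F F' G B (m + a) (n + b) v := by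
  simp only [normalSum]
  refine Finset.sum_congr rfl fun r _ => Finset.sum_congr rfl fun r' _ =>
    Finset.sum_congr rfl fun s _ => Finset.sum_congr rfl fun s' _ => ?_
  rw [show m + r - s + a = m + a + r - (s : ℤ) by ring,
    show n + r' - s' + b = n + b + r' - (s' : ℤ) by ring]

variable {F F'}

/-- Both orders of a product must be compared inside one dressing; this is where the commutativity
of the `em` series, and of the `ep` series, enters. -/
theorem normalSum_swap (hem : CoeffCommute F.em F'.em) (hep : CoeffCommute F.ep F'.ep)
    (G : ℤ → ℤ → Module.End ℂ V) (B : ℕ) (m n : ℤ) (v : V) :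
    normalSum F' F (fun n m => G m n) B n m v = normalSum F F' G B m n v := by
  simp only [normalSum]
  rw [Finset.sum_comm]
  refine Finset.sum_congr rfl fun r _ => Finset.sum_congr rfl fun r' _ => ?_
  rw [Finset.sum_comm]
  refine Finset.sum_congr rfl fun s _ => Finset.sum_congr rfl fun s' _ => ?_
  rw [← Module.End.mul_apply (coeff s F.ep), (hep s s').eq, ← Module.End.mul_apply (coeff r' F'.em),
    ← (hem r r').eq]
  rfl

/-- If `em'(w) x(z) = P(w/z) x(z) em'(w)` and `ep(z^{-1})` commutes with the second dressed field,
then multiplying the product of the two fields by `P(w/z)` puts it in normal order. -/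
theorem sum_smul_op_op (hd : LocallyBounded d) {P : ℂ⟦X⟧}
    (hP : ∀ (r : ℕ) (p : ℤ), coeff r F'.em * F.x p
      = ∑ y ∈ antidiagonal r, coeff y.1 P • (F.x (p - y.1) * coeff y.2 F'.em))
    (hc : ∀ (s : ℕ) (n : ℤ), Commute (coeff s F.ep) (F'.op hd n))
    {N m n : ℤ} {v : V} (hv : KilledAbove d N v) {B : ℕ} (h₁ : N < B) (h₂ : N - n < B)
    (h₃ : N - m - n < B) :
    ∑ u ∈ range B, coeff u P • F.op hd (m - u) (F'.op hd (n + u) v)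
      = normalSum F F' (fun m n => F.x m * F'.x n) B m n v := by
  set T : ℕ → ℕ → ℕ → ℕ → ℕ → V := fun u r s t s' => coeff u P •
    coeff r F.em (F.x (m + r - s - u) (coeff t F'.em (F'.x (n + ((u + t : ℕ) : ℤ) - s')
      (coeff s' F'.ep (coeff s F.ep v))))) with hT
  have hL : ∀ u ∈ range B, coeff u P • F.op hd (m - u) (F'.op hd (n + u) v)
      = ∑ r ∈ range B, ∑ s ∈ range B, ∑ t ∈ range B, ∑ s' ∈ range B, T u r s t s' := by
    intro u _
    -- The inner operator has degree `n + u` and the outer one `m - u`; the total `m + n` is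
    -- independent of `u`, so one bound on `B` serves all terms.
    rw [F.op_eq_sum hd (hv.apply (F'.op_mem hd (n + u))) (B := B) (by omega) (by omega)]
    simp only [Finset.smul_sum]
    refine Finset.sum_congr rfl fun r _ => Finset.sum_congr rfl fun s _ => ?_
    simp only [term, Module.End.mul_apply]
    -- `ep` passes the second field as a whole, before that field is expanded; hence no contraction
    -- arises on this side.
    rw [← Module.End.mul_apply (coeff s F.ep), (hc s _).eq, Module.End.mul_apply,
      F'.op_eq_sum hd (hv.apply (F.ep_mem s)) (B := B) (by omega) (by omega)]
    simp only [map_sum, Finset.smul_sum]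
    refine Finset.sum_congr rfl fun t _ => Finset.sum_congr rfl fun s' _ => ?_
    simp only [hT, term, Module.End.mul_apply]
    rw [show m - u + r - s = m + r - s - (u : ℤ) by ring,
      show n + u + t - s' = n + ((u + t : ℕ) : ℤ) - (s' : ℤ) by push_cast; ring]
  have hR : ∀ r r' s s' : ℕ, coeff r F.em (coeff r' F'.em ((F.x (m + r - s) * F'.x (n + r' - s'))
      (coeff s' F'.ep (coeff s F.ep v)))) = ∑ y ∈ antidiagonal r', T y.1 r s y.2 s' := by
    intro r r' s s'
    rw [Module.End.mul_apply, ← Module.End.mul_apply (coeff r' F'.em), hP, LinearMap.sum_apply,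
      map_sum]
    refine Finset.sum_congr rfl fun y hy => ?_
    simp only [LinearMap.smul_apply, map_smul, Module.End.mul_apply, hT,
      HasAntidiagonal.mem_antidiagonal.mp hy]
  rw [Finset.sum_congr rfl hL, Finset.sum_comm]
  simp only [normalSum, hR]
  refine Finset.sum_congr rfl fun r _ => ?_
  refine Finset.sum_comm.trans (Eq.trans ?_ Finset.sum_comm)
  refine Finset.sum_congr rfl fun s _ => ?_
  refine (Finset.sum_congr rfl fun u _ => Finset.sum_comm).trans
    (Finset.sum_comm.trans (Eq.trans ?_ Finset.sum_comm))
  refine Finset.sum_congr rfl fun s' _ => ?_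
  -- The index `u` of the contraction series and the index `t` of `em'` recombine into the single
  -- index `r' = u + t` of the normally ordered sum.
  rw [sum_range_sum_antidiagonal B (fun u t => T u r s t s')]
  intro u t hut
  simp only [hT]
  rw [← Module.End.mul_apply (F'.x _), (hv.apply (F.ep_mem s)) (n + ((u + t : ℕ) : ℤ) - s' + s')
    (by omega) _ (F'.x_mul_ep_mem _ _)]
  simp only [map_zero, smul_zero]

theorem support_smul_op_op_subset (hd : LocallyBounded d) (P : ℂ⟦X⟧) {N : ℤ} (m n : ℤ) {v : V}
    (hv : KilledAbove d N v) {B : ℕ} (h : N - n < B) :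
    (Function.support fun u : ℕ => coeff u P • F.op hd (m - u) (F'.op hd (n + u) v))
      ⊆ (range B : Finset ℕ) := by
  intro u hu
  rw [Function.mem_support] at hu
  contrapose! hu
  simp only [coe_range, Set.mem_Iio, not_lt] at hu
  rw [hv (n + u) (by omega) _ (F'.op_mem hd _), map_zero, smul_zero]

/-- Stated for all large `B` rather than for an explicit one, so that finitely many such identities
can be intersected. -/
theorem eventually_finsum_smul_op_op (hd : LocallyBounded d) {P : ℂ⟦X⟧}
    (hP : ∀ (r : ℕ) (p : ℤ), coeff r F'.em * F.x p
      = ∑ y ∈ antidiagonal r, coeff y.1 P • (F.x (p - y.1) * coeff y.2 F'.em))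
    (hc : ∀ (s : ℕ) (n : ℤ), Commute (coeff s F.ep) (F'.op hd n)) (m n : ℤ) (v : V) :
    ∀ᶠ B : ℕ in Filter.atTop,
      ∑ᶠ u : ℕ, coeff u P • F.op hd (m - u) (F'.op hd (n + u) v)
        = normalSum F F' (fun m n => F.x m * F'.x n) B m n v := by
  obtain ⟨N, hv⟩ := hd v
  filter_upwards [Filter.eventually_ge_atTop
    (max (max (N + 1) (N - n + 1)) (N - m - n + 1)).toNat] with B hB
  rw [finsum_eq_sum_of_support_subset _ (support_smul_op_op_subset hd P m n hv (B := B) (by omega)),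
    sum_smul_op_op hd hP hc hv (by omega) (by omega) (by omega)]

/-- The normally ordered product of `δ(c^{-2} z/w)`-type series. -/
theorem eventually_normalSum_delta (hd : LocallyBounded d) {c : ℂ} (hc0 : c ≠ 0)
    {Θ : ℤ → Module.End ℂ V} (hΘ : ∀ l, Θ l ∈ Deg d l) (m n : ℤ) (v : V) :
    ∀ᶠ B : ℕ in Filter.atTop,
      normalSum F F' (fun m n => c ^ (m - n) • Θ (m + n)) B m n v
        = c ^ (m - n) • ∑ ρ ∈ range B, ∑ σ ∈ range B,
          (coeff ρ (scaleX c F.em * scaleX c⁻¹ F'.em) * (Θ (m + n + ρ - σ)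
            * coeff σ (scaleX c F'.ep * scaleX c⁻¹ F.ep))) v := by
  obtain ⟨N, hv⟩ := hd v
  filter_upwards [Filter.eventually_ge_atTop (max (N + 1) (N - m - n + 1)).toNat] with B hB
  have h₁ : N < B := by omega
  have h₂ : N - m - n < B := by omega
  set T : ℕ → ℕ → ℕ → ℕ → V := fun r r' s s' => (c ^ r * c⁻¹ ^ r' * (c ^ s' * c⁻¹ ^ s)) •
    coeff r F.em (coeff r' F'.em (Θ (m + n + ((r + r' : ℕ) : ℤ) - ((s' + s : ℕ) : ℤ))
      (coeff s' F'.ep (coeff s F.ep v)))) with hT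
  have hL : normalSum F F' (fun m n => c ^ (m - n) • Θ (m + n)) B m n v
      = c ^ (m - n) • ∑ r ∈ range B, ∑ r' ∈ range B, ∑ s ∈ range B, ∑ s' ∈ range B,
          T r r' s s' := by
    simp only [normalSum, Finset.smul_sum]
    refine Finset.sum_congr rfl fun r _ => Finset.sum_congr rfl fun r' _ =>
      Finset.sum_congr rfl fun s _ => Finset.sum_congr rfl fun s' _ => ?_
    rw [LinearMap.smul_apply, map_smul, map_smul, hT, smul_smul]
    congr 1
    -- The delta function substitutes `z = cζ`, `w = c⁻¹ζ`: the powers of `c` distribute over the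
    -- four dressing series as rescalings, inverted for the series in `z⁻¹` and `w⁻¹`.
    · rw [show m + r - s - (n + r' - s') = (m - n) + r - r' + (s' - (s : ℤ)) by ring,
        zpow_add₀ hc0, zpow_sub₀ hc0 _ (s : ℤ), zpow_sub₀ hc0 _ (r' : ℤ), zpow_add₀ hc0]
      simp only [zpow_natCast, inv_pow]
      field_simp
    · congr 4
      push_cast
      ring
  have hep0 : ∀ s s' : ℕ, B ≤ s' + s → coeff s' F'.ep (coeff s F.ep v) = 0 := by
    intro s s' hs
    rw [← Module.End.mul_apply]
    exact hv _ (by omega) _ (mul_mem_Deg (F'.ep_mem s') (F.ep_mem s))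
  have hS : ∀ r r' : ℕ, ∑ s ∈ range B, ∑ s' ∈ range B, T r r' s s'
      = ∑ σ ∈ range B, (c ^ r * c⁻¹ ^ r') • coeff r F.em (coeff r' F'.em
          (Θ (m + n + ((r + r' : ℕ) : ℤ) - σ)
            (coeff σ (scaleX c F'.ep * scaleX c⁻¹ F.ep) v))) := by
    intro r r'
    rw [Finset.sum_comm, ← sum_range_sum_antidiagonal B (fun s' s => T r r' s s')]
    · refine Finset.sum_congr rfl fun σ _ => ?_
      simp only [coeff_mul, coeff_scaleX, LinearMap.sum_apply, map_sum, Finset.smul_sum]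
      refine Finset.sum_congr rfl fun p hp => ?_
      rw [hT, smul_mul_smul_comm, LinearMap.smul_apply, map_smul, map_smul, map_smul, smul_smul,
        ← HasAntidiagonal.mem_antidiagonal.mp hp]
      rfl
    · intro s' s hs
      simp only [hT]
      rw [hep0 s s' hs]
      simp
  rw [hL]
  congr 1
  simp only [hS]
  rw [← sum_range_sum_antidiagonal B (fun r r' => ∑ σ ∈ range B, (c ^ r * c⁻¹ ^ r') •
    coeff r F.em (coeff r' F'.em (Θ (m + n + ((r + r' : ℕ) : ℤ) - σ)
      (coeff σ (scaleX c F'.ep * scaleX c⁻¹ F.ep) v))))]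
  · refine Finset.sum_congr rfl fun ρ _ => ?_
    rw [Finset.sum_comm]
    refine Finset.sum_congr rfl fun σ _ => ?_
    rw [coeff_mul ρ, Finset.sum_mul, LinearMap.sum_apply]
    refine Finset.sum_congr rfl fun p hp => ?_
    rw [coeff_scaleX, coeff_scaleX, smul_mul_smul_comm, smul_mul_assoc, LinearMap.smul_apply,
      HasAntidiagonal.mem_antidiagonal.mp hp]
    rfl
  · intro r r' hr
    refine Finset.sum_eq_zero fun σ _ => ?_
    have hmem : coeff σ (scaleX c F'.ep * scaleX c⁻¹ F.ep) ∈ Deg d σ := by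
      rw [coeff_mul]
      refine Submodule.sum_mem _ fun p hp => ?_
      rw [← HasAntidiagonal.mem_antidiagonal.mp hp, Nat.cast_add, coeff_scaleX, coeff_scaleX]
      exact mul_mem_Deg (Submodule.smul_mem _ _ (F'.ep_mem _))
        (Submodule.smul_mem _ _ (F.ep_mem _))
    rw [← Module.End.mul_apply (Θ _), hv _ _ _ (mul_mem_Deg (hΘ _) hmem)]
    · simp
    · omega

/-- With the left dressing trivial, the sum over `σ` is a coefficient of `K Ψ S` with `S` the merged
right dressing, and `Ψ S = 1` leaves `K` in total degree zero. -/
theorem eventually_normalSum_psi (hd : LocallyBounded d) {c : ℂ} (hc0 : c ≠ 0)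
    {Θ : ℤ → Module.End ℂ V} (hΘ : ∀ l, Θ l ∈ Deg d l) {K : Module.End ℂ V}
    {Ψ : (Module.End ℂ V)⟦X⟧} (hpos : ∀ l : ℕ, Θ l = K * coeff l Ψ) (hneg : ∀ l < 0, Θ l = 0)
    (hem : scaleX c F.em * scaleX c⁻¹ F'.em = 1)
    (hep : Ψ * (scaleX c F'.ep * scaleX c⁻¹ F.ep) = 1) (m n : ℤ) (v : V) :
    ∀ᶠ B : ℕ in Filter.atTop,
      normalSum F F' (fun m n => c ^ (m - n) • Θ (m + n)) B m n v
        = c ^ (m - n) • if m + n = 0 then K v else 0 := by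
  filter_upwards [eventually_normalSum_delta (F := F) (F' := F') hd hc0 hΘ m n v,
    Filter.eventually_gt_atTop (m + n).toNat] with B hB hB'
  rw [hB, hem]
  congr 1
  rw [Finset.sum_eq_single_of_mem 0 (Finset.mem_range.mpr (by omega))
    (fun ρ _ hρ => by simp [coeff_one, hρ])]
  set S := scaleX c F'.ep * scaleX c⁻¹ F.ep
  simp only [coeff_zero_one, one_mul, Nat.cast_zero, add_zero]
  rcases lt_or_ge (m + n) 0 with hl | hl
  · rw [if_neg hl.ne]
    refine Finset.sum_eq_zero fun σ _ => ?_
    rw [hneg _ (by omega)]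
    simp
  · obtain ⟨l, hl'⟩ := Int.eq_ofNat_of_zero_le hl
    have hz : ∀ σ ∈ range B, σ ∉ range (l + 1) → (Θ (m + n - σ) * coeff σ S) v = 0 := by
      intro σ _ hσ
      rw [Finset.mem_range] at hσ
      rw [hneg _ (by omega)]
      simp
    rw [← Finset.sum_subset (Finset.range_subset_range.mpr (by omega)) hz, hl']
    have hK : ∑ σ ∈ range (l + 1), Θ ((l : ℤ) - σ) * coeff σ S = K * coeff l (Ψ * S) := by
      rw [coeff_mul, ← Finset.Nat.sum_antidiagonal_swap,
        Finset.Nat.sum_antidiagonal_eq_sum_range_succ_mk, Finset.mul_sum]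
      refine Finset.sum_congr rfl fun σ hσ => ?_
      rw [Finset.mem_range] at hσ
      rw [← Nat.cast_sub (by omega), hpos, mul_assoc]
      rfl
    rw [← LinearMap.sum_apply, hK, hep, coeff_one]
    norm_cast
    split_ifs <;> simp

/-- The mirror image: the right dressing is trivial and the left one inverts `Φ`. Here `K` stands
between the two series, so it must commute with the left dressing. -/
theorem eventually_normalSum_phi (hd : LocallyBounded d) {c : ℂ} (hc0 : c ≠ 0)
    {Θ : ℤ → Module.End ℂ V} (hΘ : ∀ l, Θ l ∈ Deg d l) {K : Module.End ℂ V}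
    {Φ : (Module.End ℂ V)⟦X⟧} (hneg : ∀ l : ℕ, Θ (-l) = K * coeff l Φ) (hpos : ∀ l > 0, Θ l = 0)
    (hK : ∀ r, Commute K (coeff r (scaleX c F.em * scaleX c⁻¹ F'.em)))
    (hem : scaleX c F.em * scaleX c⁻¹ F'.em * Φ = 1)
    (hep : scaleX c F'.ep * scaleX c⁻¹ F.ep = 1) (m n : ℤ) (v : V) :
    ∀ᶠ B : ℕ in Filter.atTop,
      normalSum F F' (fun m n => c ^ (m - n) • Θ (m + n)) B m n v
        = c ^ (m - n) • if m + n = 0 then K v else 0 := by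
  filter_upwards [eventually_normalSum_delta (F := F) (F' := F') hd hc0 hΘ m n v,
    Filter.eventually_gt_atTop (-(m + n)).toNat] with B hB hB'
  rw [hB, hep]
  congr 1
  rw [Finset.sum_comm, Finset.sum_eq_single_of_mem 0 (Finset.mem_range.mpr (by omega))
    (fun ρ _ hρ => by simp [coeff_one, hρ])]
  set M := scaleX c F.em * scaleX c⁻¹ F'.em
  simp only [coeff_zero_one, mul_one, Nat.cast_zero, sub_zero]
  rcases lt_or_ge 0 (m + n) with hl | hl
  · rw [if_neg hl.ne']
    refine Finset.sum_eq_zero fun σ _ => ?_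
    rw [hpos _ (by omega)]
    simp
  · obtain ⟨l, hl'⟩ := Int.eq_ofNat_of_zero_le (neg_nonneg.mpr hl)
    have hl'' : m + n = -l := by omega
    have hz : ∀ σ ∈ range B, σ ∉ range (l + 1) → (coeff σ M * Θ (m + n + σ)) v = 0 := by
      intro σ _ hσ
      rw [Finset.mem_range] at hσ
      rw [hpos _ (by omega)]
      simp
    rw [← Finset.sum_subset (Finset.range_subset_range.mpr (by omega)) hz, hl'']
    have hsum : ∑ σ ∈ range (l + 1), coeff σ M * Θ (-(l : ℤ) + σ) = K * coeff l (M * Φ) := by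
      rw [coeff_mul, Finset.Nat.sum_antidiagonal_eq_sum_range_succ_mk, Finset.mul_sum]
      refine Finset.sum_congr rfl fun σ hσ => ?_
      rw [Finset.mem_range] at hσ
      rw [show -(l : ℤ) + σ = -((l - σ : ℕ) : ℤ) by omega, hneg, ← mul_assoc, ← (hK σ).eq,
        mul_assoc]
    rw [← LinearMap.sum_apply, hsum, hem, coeff_one]
    norm_cast
    split_ifs <;> simp_all

end DressedField

/-! ## Powers of `q` -/

section QPow

variable (h : ℂ)

theorem qpow_add (a b : ℚ) : qpow h (a + b) = qpow h a * qpow h b := by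
  rw [qpow, qpow, qpow, ← Complex.exp_add]
  push_cast
  ring_nf

@[simp]
theorem qpow_zero : qpow h 0 = 1 := by simp [qpow]

theorem qpow_ne_zero (a : ℚ) : qpow h a ≠ 0 := Complex.exp_ne_zero _

theorem qpow_neg (a : ℚ) : qpow h (-a) = (qpow h a)⁻¹ := by
  rw [qpow, qpow, ← Complex.exp_neg]
  push_cast
  ring_nf

theorem qpow_mul_natCast (a : ℚ) (n : ℕ) : qpow h (a * n) = qpow h a ^ n := by
  rw [qpow, qpow, ← Complex.exp_nat_mul]
  push_cast
  ring_nf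

theorem qpow_mul_intCast (a : ℚ) (n : ℤ) : qpow h (a * n) = qpow h a ^ n := by
  rw [qpow, qpow, ← Complex.exp_int_mul]
  push_cast
  ring_nf

theorem qnum_neg (a : ℚ) : qnum h (-a) = -qnum h a := by
  rw [qnum, qnum, neg_neg]
  ring

variable {h}

/-- If `q^b = 1` with `b > 0` rational, raising to the denominator of `b` gives a positive integral
power of `q` equal to one. -/
theorem qpow_ne_one (hq : ∀ n : ℕ, 0 < n → Complex.exp h ^ n ≠ 1) {a : ℚ} (ha : a ≠ 0) :
    qpow h a ≠ 1 := by
  have key : ∀ b : ℚ, 0 < b → qpow h b ≠ 1 := by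
    intro b hb hb1
    apply hq b.num.toNat (by simpa using Rat.num_pos.mpr hb)
    have h1 : qpow h (b * b.den) = 1 := by rw [qpow_mul_natCast, hb1, one_pow]
    have h2 : (b.num.toNat : ℚ) = b * b.den := by
      rw [Rat.mul_den_eq_num]
      exact_mod_cast Int.toNat_of_nonneg (Rat.num_pos.mpr hb).le
    rw [← h2, ← one_mul (b.num.toNat : ℚ), qpow_mul_natCast] at h1
    simpa [qpow] using h1
  rcases lt_or_gt_of_ne ha with ha | ha
  · intro h1
    apply key (-a) (neg_pos.mpr ha)
    rw [qpow_neg, h1, inv_one]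
  · exact key a ha

theorem qpow_sub_qpow_neg_ne_zero (hq : ∀ n : ℕ, 0 < n → Complex.exp h ^ n ≠ 1) {a : ℚ}
    (ha : a ≠ 0) : qpow h a - qpow h (-a) ≠ 0 := by
  intro h0
  apply qpow_ne_one hq (a := a + a) (by simpa [← two_mul] using ha)
  rw [qpow_add]
  nth_rw 1 [sub_eq_zero.mp h0]
  rw [← qpow_add, neg_add_cancel, qpow_zero]

theorem qnum_mul_natCast_ne_zero (hq : ∀ n : ℕ, 0 < n → Complex.exp h ^ n ≠ 1) {κ : ℚ}
    (hκ : κ ≠ 0) {n : ℕ} (hn : n ≠ 0) : qnum h (κ * n) ≠ 0 :=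
  div_ne_zero (qpow_sub_qpow_neg_ne_zero hq (mul_ne_zero hκ (Nat.cast_ne_zero.mpr hn)))
    (qpow_sub_qpow_neg_ne_zero hq one_ne_zero)

end QPow

/-! ## Exponentials of combinations of commuting elements -/

section ExpSeries

variable {A : Type*} [Ring A] [Algebra ℂ A]

/-- `exp (∑ α_n g_n X^n)`. -/
def expSeries (g : ℕ → A) (α : ℕ → ℂ) : A⟦X⟧ := formalExp (PowerSeries.mk fun n => α n • g n)

theorem scaleX_expSeries (c : ℂ) (g : ℕ → A) (α : ℕ → ℂ) :
    scaleX c (expSeries g α) = expSeries g fun n => c ^ n * α n := by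
  rw [expSeries, scaleX_formalExp, expSeries]
  congr 1
  ext n
  simp [smul_smul]

theorem coeffCommute_mk_smul {g g' : ℕ → A} (hg : ∀ m n, Commute (g m) (g' n)) (α β : ℕ → ℂ) :
    CoeffCommute (PowerSeries.mk fun n => α n • g n) (PowerSeries.mk fun n => β n • g' n) := by
  intro m n
  simp only [coeff_mk]
  exact ((hg m n).smul_left _).smul_right _

/-- Turns each cancellation between dressing series into an identity of scalar sequences. -/
theorem expSeries_mul {g : ℕ → A} (h0 : g 0 = 0) (hg : ∀ m n, Commute (g m) (g n))
    (α β : ℕ → ℂ) :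
    expSeries g α * expSeries g β = expSeries g fun n => α n + β n := by
  rw [expSeries, expSeries, ← formalExp_add (by rw [coeff_mk, h0, smul_zero])
    (by rw [coeff_mk, h0, smul_zero]) (coeffCommute_mk_smul hg _ _) (coeffCommute_mk_smul hg _ _)
    (coeffCommute_mk_smul hg _ _), expSeries]
  congr 1
  ext n
  simp [add_smul]

/-- Index zero is exempt because `g 0 = 0`; the sequences in use may take an irrelevant value there,
such as the constant `q - q⁻¹` in `ψ_i`. -/
theorem expSeries_eq_one {g : ℕ → A} (h0 : g 0 = 0) {α : ℕ → ℂ} (hα : ∀ n, n ≠ 0 → α n = 0) :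
    expSeries g α = 1 := by
  have : (PowerSeries.mk fun n => α n • g n) = 0 := by
    ext n
    rcases eq_or_ne n 0 with rfl | hn
    · simp [h0]
    · simp [hα n hn]
  rw [expSeries, this, formalExp_zero]

end ExpSeries

/-! ## The relations in a module of level `κ` -/

section LevelModule

open Finset

variable {ι : Type*} [Fintype ι] (C : CartanDatum ι) (h : ℂ) (κ : ℚ)
variable (V : Type*) [AddCommGroup V] [Module ℂ V] [Module (Uq C h) V] [IsScalarTower ℂ (Uq C h) V]

/-- The representation on `V`, on the free algebra. -/
def freeRep : FreeAlgebra ℂ (Gen ι) →ₐ[ℂ] Module.End ℂ V :=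
  (Algebra.lsmul ℂ ℂ V : Uq C h →ₐ[ℂ] Module.End ℂ V).comp (Uq.mk C h)

/-- The operator `d`. -/
def dOp : Module.End ℂ V := Algebra.lsmul ℂ ℂ V (Uq.d C h)

/-- The operators `a_i(n)`. -/
def aOp (i : ι) (n : ℤ) : Module.End ℂ V := Algebra.lsmul ℂ ℂ V (Uq.a C h i n)

/-- The operators `x_i^±(n)`. -/
def xOp (ε : ℤˣ) (i : ι) (n : ℤ) : Module.End ℂ V := Algebra.lsmul ℂ ℂ V (Uq.x C h ε i n)

/-- The operators `k_i`. -/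
def kOp (i : ι) : Module.End ℂ V := Algebra.lsmul ℂ ℂ V (Uq.k C h i)

/-- The operators `k_i⁻¹`. -/
def kInvOp (i : ι) : Module.End ℂ V := Algebra.lsmul ℂ ℂ V (Uq.kInv C h i)

theorem freeRep_gen_d : freeRep C h V (Free.gen Gen.d) = dOp C h V := rfl

theorem freeRep_a (i : ι) (n : ℤ) : freeRep C h V (Free.a i n) = aOp C h V i n := rfl

theorem freeRep_x (ε : ℤˣ) (i : ι) (n : ℤ) :
    freeRep C h V (Free.x ε i n) = xOp C h V ε i n := rfl

theorem freeRep_gen_k (i : ι) : freeRep C h V (Free.gen (Gen.k i)) = kOp C h V i := rfl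

theorem freeRep_gen_kInv (i : ι) :
    freeRep C h V (Free.gen (Gen.kInv i)) = kInvOp C h V i := rfl

variable {C h V}

theorem freeRep_rel {s t : FreeAlgebra ℂ (Gen ι)} (hst : Rel C h s t) :
    freeRep C h V s = freeRep C h V t :=
  congrArg (Algebra.lsmul ℂ ℂ V : Uq C h →ₐ[ℂ] Module.End ℂ V) (RingQuot.mkAlgHom_rel ℂ hst)

variable (C h V)

@[simp]
theorem aOp_zero (i : ι) : aOp C h V i 0 = 0 := by
  rw [← freeRep_a, Free.a]
  simp

theorem aOp_mem (i : ι) (n : ℤ) : aOp C h V i n ∈ Deg (dOp C h V) n := by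
  have := freeRep_rel (V := V) (Rel.d_a (C := C) (h := h) i n)
  rw [map_sub, map_mul, map_mul, map_smul, freeRep_a, freeRep_gen_d, sub_eq_iff_eq_add'] at this
  exact this

theorem xOp_mem (ε : ℤˣ) (i : ι) (n : ℤ) : xOp C h V ε i n ∈ Deg (dOp C h V) n := by
  have := freeRep_rel (V := V) (Rel.d_x (C := C) (h := h) ε i n)
  rw [map_sub, map_mul, map_mul, map_smul, freeRep_x, freeRep_gen_d, sub_eq_iff_eq_add'] at this
  exact this

theorem kOp_mul_kInvOp (i : ι) : kOp C h V i * kInvOp C h V i = 1 := by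
  have := freeRep_rel (V := V) (Rel.k_mul_inv (C := C) (h := h) i)
  rwa [map_mul, map_one] at this

theorem kInvOp_mul_kOp (i : ι) : kInvOp C h V i * kOp C h V i = 1 := by
  have := freeRep_rel (V := V) (Rel.k_inv_mul (C := C) (h := h) i)
  rwa [map_mul, map_one] at this

theorem commute_kInvOp {i : ι} {T : Module.End ℂ V} (hT : Commute (kOp C h V i) T) :
    Commute (kInvOp C h V i) T := by
  let u : (Module.End ℂ V)ˣ :=
    ⟨kOp C h V i, kInvOp C h V i, kOp_mul_kInvOp C h V i, kInvOp_mul_kOp C h V i⟩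
  exact Commute.units_inv_left (u := u) hT

theorem commute_kOp_dOp (i : ι) : Commute (kOp C h V i) (dOp C h V) := by
  have := freeRep_rel (V := V) (Rel.k_d (C := C) (h := h) i)
  rwa [map_mul, map_mul] at this

theorem commute_kOp_aOp (i j : ι) (n : ℤ) : Commute (kOp C h V i) (aOp C h V j n) := by
  have := freeRep_rel (V := V) (Rel.k_a (C := C) (h := h) i j n)
  rwa [map_mul, map_mul] at this

theorem kOp_mem (i : ι) : kOp C h V i ∈ Deg (dOp C h V) 0 := by
  rw [mem_Deg, (commute_kOp_dOp C h V i).eq]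
  simp

theorem kInvOp_mem (i : ι) : kInvOp C h V i ∈ Deg (dOp C h V) 0 := by
  rw [mem_Deg, (commute_kInvOp C h V (commute_kOp_dOp C h V i)).eq]
  simp

theorem xOp_xOp (ε : ℤˣ) (i j : ι) (m n : ℤ) :
    xOp C h V ε i (m + 1) * xOp C h V ε j n
        - qpow h (((ε : ℤ) : ℚ) * C.form i j) • (xOp C h V ε i m * xOp C h V ε j (n + 1))
      = qpow h (((ε : ℤ) : ℚ) * C.form i j) • (xOp C h V ε j n * xOp C h V ε i (m + 1))
        - xOp C h V ε j (n + 1) * xOp C h V ε i m := by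
  simpa only [map_sub, map_mul, map_smul, freeRep_x] using
    freeRep_rel (V := V) (Rel.x_x (C := C) (h := h) ε i j m n)

theorem xOp_xOp_of_ne {i j : ι} (hij : i ≠ j) (m n : ℤ) :
    xOp C h V 1 i m * xOp C h V (-1) j n - xOp C h V (-1) j n * xOp C h V 1 i m = 0 := by
  simpa only [map_sub, map_mul, map_zero, freeRep_x] using
    freeRep_rel (V := V) (Rel.x_plus_minus_of_ne (C := C) (h := h) i j hij m n)

theorem CartanDatum.form_comm (i j : ι) : C.form i j = C.form j i := C.symm i j

/-- The operators `ψ_i(n)`. -/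
def psiOp (i : ι) (n : ℤ) : Module.End ℂ V := freeRep C h V (Free.psi h i n)

/-- The operators `φ_i(n)`. -/
def phiOp (i : ι) (n : ℤ) : Module.End ℂ V := freeRep C h V (Free.phi h i n)

theorem freeRep_coeff_formalExp_a (i : ι) (c : ℂ) (s : ℕ → ℤ) (n : ℕ) :
    freeRep C h V (coeff n (formalExp (PowerSeries.mk fun m : ℕ => c • Free.a i (s m))))
      = coeff n (expSeries (fun m => aOp C h V i (s m)) fun _ => c) := by
  rw [coeff_formalExp_map, expSeries]
  congr 2
  ext m : 1
  rw [coeff_map, coeff_mk, coeff_mk, ← freeRep_a, ← map_smul]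
  rfl

theorem psiOp_natCast (i : ι) (n : ℕ) :
    psiOp C h V i n = kOp C h V i * coeff n
      (expSeries (fun m : ℕ => aOp C h V i m) fun _ => qpow h 1 - qpow h (-1)) := by
  rw [psiOp, Free.psi, if_pos (Int.natCast_nonneg n), map_mul, freeRep_gen_k, Int.toNat_natCast,
    freeRep_coeff_formalExp_a C h V i _ (fun m : ℕ => (m : ℤ))]

theorem psiOp_of_neg (i : ι) {n : ℤ} (hn : n < 0) : psiOp C h V i n = 0 := by
  rw [psiOp, Free.psi, if_neg (not_le.mpr hn), map_zero]

theorem phiOp_neg_natCast (i : ι) (n : ℕ) :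
    phiOp C h V i (-n) = kInvOp C h V i * coeff n
      (expSeries (fun m : ℕ => aOp C h V i (-m)) fun _ => qpow h (-1) - qpow h 1) := by
  rw [phiOp, Free.phi, if_pos (neg_nonpos.mpr (Int.natCast_nonneg n)), map_mul, freeRep_gen_kInv,
    neg_neg, Int.toNat_natCast, freeRep_coeff_formalExp_a C h V i _ (fun m : ℕ => -(m : ℤ))]

theorem phiOp_of_pos (i : ι) {n : ℤ} (hn : 0 < n) : phiOp C h V i n = 0 := by
  rw [phiOp, Free.phi, if_neg (not_le.mpr hn), map_zero]

theorem coeff_expSeries_aOp_mem (i : ι) (α : ℕ → ℂ) (n : ℕ) :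
    coeff n (expSeries (fun m : ℕ => aOp C h V i m) α) ∈ Deg (dOp C h V) n := by
  have := coeff_formalExp_mem_Deg (d := dOp C h V) (σ := 1)
    (f := PowerSeries.mk fun m : ℕ => α m • aOp C h V i m)
    (fun m => by
      rw [coeff_mk, one_mul]
      exact Submodule.smul_mem _ _ (aOp_mem C h V i m)) n
  rwa [one_mul] at this

theorem coeff_expSeries_aOp_neg_mem (i : ι) (α : ℕ → ℂ) (n : ℕ) :
    coeff n (expSeries (fun m : ℕ => aOp C h V i (-m)) α) ∈ Deg (dOp C h V) (-n) := by
  have := coeff_formalExp_mem_Deg (d := dOp C h V) (σ := -1)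
    (f := PowerSeries.mk fun m : ℕ => α m • aOp C h V i (-m))
    (fun m => by
      rw [coeff_mk, neg_one_mul]
      exact Submodule.smul_mem _ _ (aOp_mem C h V i (-m))) n
  rwa [neg_one_mul] at this

theorem psiOp_mem (i : ι) (n : ℤ) : psiOp C h V i n ∈ Deg (dOp C h V) n := by
  rcases lt_or_ge n 0 with hn | hn
  · rw [psiOp_of_neg C h V i hn]
    exact Submodule.zero_mem _
  · obtain ⟨n, rfl⟩ := Int.eq_ofNat_of_zero_le hn
    rw [psiOp_natCast]
    simpa using mul_mem_Deg (kOp_mem C h V i) (coeff_expSeries_aOp_mem C h V i _ n)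

theorem phiOp_mem (i : ι) (n : ℤ) : phiOp C h V i n ∈ Deg (dOp C h V) n := by
  rcases lt_or_ge 0 n with hn | hn
  · rw [phiOp_of_pos C h V i hn]
    exact Submodule.zero_mem _
  · obtain ⟨l, hl⟩ := Int.eq_ofNat_of_zero_le (neg_nonneg.mpr hn)
    rw [show n = -(l : ℤ) by omega, phiOp_neg_natCast]
    simpa using mul_mem_Deg (kInvOp_mem C h V i) (coeff_expSeries_aOp_neg_mem C h V i _ l)

/-- The coefficients `± q^{∓κn/2} / [κn]` of `a_i(n) z^{-n}` in the exponent of `E_+^±(α_i, z)`. -/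
def expCoeff (h : ℂ) (κ : ℚ) (ε : ℤˣ) (n : ℕ) : ℂ :=
  ((ε : ℤ) : ℂ) * (qpow h (-(((ε : ℤ) : ℚ) * κ * n / 2)) / qnum h (κ * n))

/-- The data of `Z^±(α_i, z) = E_-^±(α_i, z) x_i^±(z) E_+^±(α_i, z)`. -/
def zField (ε : ℤˣ) (i : ι) : DressedField (dOp C h V) where
  em := expSeries (fun m : ℕ => aOp C h V i (-m)) fun n => -expCoeff h κ ε n
  x := xOp C h V ε i
  ep := expSeries (fun m : ℕ => aOp C h V i m) (expCoeff h κ ε)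
  em_mem := coeff_expSeries_aOp_neg_mem C h V i _
  x_mem := xOp_mem C h V ε i
  ep_mem := coeff_expSeries_aOp_mem C h V i _

theorem lsmul_coeff_EMinus (ε : ℤˣ) (i : ι) (n : ℕ) :
    Algebra.lsmul ℂ ℂ V (coeff n (EMinus C h κ ε i)) = coeff n (zField C h κ V ε i).em := by
  rw [EMinus, coeff_formalExp_map]
  simp only [zField, expSeries]
  congr 2
  ext m : 1
  rw [coeff_map, coeff_mk, coeff_mk, expCoeff, neg_mul, aOp, ← map_smul]
  rfl

theorem lsmul_coeff_EPlus (ε : ℤˣ) (i : ι) (n : ℕ) :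
    Algebra.lsmul ℂ ℂ V (coeff n (EPlus C h κ ε i)) = coeff n (zField C h κ V ε i).ep := by
  rw [EPlus, coeff_formalExp_map]
  simp only [zField, expSeries]
  congr 2
  ext m : 1
  rw [coeff_map, coeff_mk, coeff_mk, expCoeff, aOp, ← map_smul]
  rfl

theorem zTerm_eq (ε : ℤˣ) (i : ι) (n : ℤ) (v : V) :
    zTerm C h κ ε i n v = fun p => (zField C h κ V ε i).term n p v := by
  ext p
  rw [DressedField.term, ← lsmul_coeff_EMinus, ← lsmul_coeff_EPlus]
  rfl

variable {C h κ V}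

/-- An operator of degree `n` maps `V_c` to `V_{c+n}`, which vanishes for large `n`; a general
vector is a finite sum of homogeneous ones. -/
theorem IsLevelModule.locallyBounded (hV : IsLevelModule C h κ V) :
    LocallyBounded (dOp C h V) := by
  intro v
  have hv : v ∈ ⨆ c : ℂ, homogeneous C h V c := by rw [hV.graded]; trivial
  induction hv using Submodule.iSup_induction' with
  | mem c v hv =>
    obtain ⟨n₀, hn₀⟩ := hV.bounded c
    refine ⟨n₀, fun n hn T hT => ?_⟩
    obtain ⟨n, rfl⟩ := Int.eq_ofNat_of_zero_le (show 0 ≤ n by omega)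
    have hTv : T v ∈ homogeneous C h V (c + n) := by
      rw [homogeneous, Module.End.mem_eigenspace_iff] at hv ⊢
      have := LinearMap.congr_fun (mem_Deg.mp hT) v
      simp only [Module.End.mul_apply, LinearMap.add_apply, LinearMap.smul_apply] at this
      rw [show dOp C h V v = c • v from hv, map_smul, ← add_smul, Int.cast_natCast] at this
      exact this
    rw [hn₀ n (by omega)] at hTv
    simpa using hTv
  | zero => exact ⟨0, fun n _ T _ => map_zero T⟩
  | add v w _ _ hv hw =>
    obtain ⟨N, hN⟩ := hv
    obtain ⟨N', hN'⟩ := hw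
    refine ⟨max N N', fun n hn T hT => ?_⟩
    rw [map_add, hN n (by omega) T hT, hN' n (by omega) T hT, add_zero]

end LevelModule

/-! ### Heisenberg and current relations at level `κ`. -/

section LevelRelations

open Finset

variable {ι : Type*} [Fintype ι] {C : CartanDatum ι} {h : ℂ} {κ : ℚ}
variable {V : Type*} [AddCommGroup V] [Module ℂ V] [Module (Uq C h) V] [IsScalarTower ℂ (Uq C h) V]

theorem IsLevelModule.freeRep_gammaHalf (hV : IsLevelModule C h κ V) :
    freeRep C h V (Free.gen Gen.gammaHalf) = qpow h (κ / 2) • 1 := by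
  ext v
  exact hV.level v

theorem IsLevelModule.freeRep_gammaHalfInv (hV : IsLevelModule C h κ V) :
    freeRep C h V (Free.gen Gen.gammaHalfInv) = (qpow h (κ / 2))⁻¹ • 1 := by
  have := freeRep_rel (V := V) (Rel.gamma_inv_mul (C := C) (h := h))
  rw [map_mul, map_one, hV.freeRep_gammaHalf, mul_smul_comm, mul_one] at this
  rw [← this, smul_smul, inv_mul_cancel₀ (qpow_ne_zero h _), one_smul]

theorem IsLevelModule.freeRep_gammaHalfPow (hV : IsLevelModule C h κ V) (m : ℤ) :
    freeRep C h V (Free.gammaHalfPow m) = qpow h (κ / 2) ^ m • 1 := by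
  rw [Free.gammaHalfPow, map_mul, map_pow, map_pow, hV.freeRep_gammaHalf, hV.freeRep_gammaHalfInv,
    smul_pow, smul_pow, one_pow, one_pow, smul_mul_smul_comm, one_mul]
  congr 1
  rcases le_total 0 m with hm | hm
  · obtain ⟨m, rfl⟩ := Int.eq_ofNat_of_zero_le hm
    simp
  · obtain ⟨l, hl⟩ := Int.eq_ofNat_of_zero_le (neg_nonneg.mpr hm)
    rw [show m = -(l : ℤ) by omega]
    simp

theorem IsLevelModule.aOp_aOp (hV : IsLevelModule C h κ V) (i j : ι) (m n : ℤ) :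
    aOp C h V i m * aOp C h V j n = aOp C h V j n * aOp C h V i m
      + (if m = -n then qnum h (C.form i j * m) / m * qnum h (κ * m) else 0) •
        (1 : Module.End ℂ V) := by
  rcases eq_or_ne m 0 with rfl | hm
  · simp
  rcases eq_or_ne n 0 with rfl | hn
  · simp [hm]
  have := freeRep_rel (V := V) (Rel.a_a (C := C) (h := h) i j m n hm hn)
  rw [map_sub, map_mul, map_mul, freeRep_a, freeRep_a, sub_eq_iff_eq_add'] at this
  rw [this]
  congr 1
  split_ifs with hmn
  · rw [map_smul, map_sub, hV.freeRep_gammaHalfPow, hV.freeRep_gammaHalfPow, ← sub_smul, smul_smul]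
    congr 1
    rw [← qpow_mul_intCast, ← qpow_mul_intCast, qnum, qnum]
    push_cast
    rw [show κ / 2 * (2 * m) = κ * m by ring, show κ / 2 * (-(2 * m)) = -(κ * m) by ring]
    ring
  · simp

theorem IsLevelModule.commute_aOp (hV : IsLevelModule C h κ V) (i j : ι) {m n : ℤ}
    (hmn : m ≠ -n) : Commute (aOp C h V i m) (aOp C h V j n) := by
  have := hV.aOp_aOp i j m n
  rwa [if_neg hmn, zero_smul, add_zero] at this

theorem IsLevelModule.commute_aOp_natCast (hV : IsLevelModule C h κ V) (i j : ι) (m n : ℕ) :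
    Commute (aOp C h V i m) (aOp C h V j n) := by
  rcases Nat.eq_zero_or_pos m with rfl | hm
  · simp
  · exact hV.commute_aOp i j (by omega)

theorem IsLevelModule.commute_aOp_neg_natCast (hV : IsLevelModule C h κ V) (i j : ι) (m n : ℕ) :
    Commute (aOp C h V i (-m)) (aOp C h V j (-n)) := by
  rcases Nat.eq_zero_or_pos m with rfl | hm
  · simp
  · exact hV.commute_aOp i j (by omega)

/-- The scalar `± [(α_i|α_j) m]/m q^{∓κ|m|/2}`. -/
def bracketCoeff (h : ℂ) (κ : ℚ) (a : ℚ) (ε : ℤˣ) (m : ℕ) : ℂ :=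
  ((ε : ℤ) : ℂ) * (qnum h (a * m) / m) * qpow h (-(((ε : ℤ) : ℚ) * κ * m / 2))

/-- Since `[am]/m` is even in `m`, the modes `m` and `-m` share one scalar, indexed by `l = |m|`. -/
theorem IsLevelModule.aOp_xOp (hV : IsLevelModule C h κ V) (ε : ℤˣ) (i j : ι) {m : ℤ} {l : ℕ}
    (hl : m = l ∨ m = -l) (n : ℤ) :
    aOp C h V i m * xOp C h V ε j n = xOp C h V ε j n * aOp C h V i m
      + bracketCoeff h κ (C.form i j) ε l • xOp C h V ε j (n + m) := by
  rcases eq_or_ne m 0 with rfl | hm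
  · rw [show l = 0 by omega]
    simp [bracketCoeff]
  have := freeRep_rel (V := V) (Rel.a_x (C := C) (h := h) ε i j m n hm)
  rw [map_sub, map_mul, map_mul, freeRep_a, freeRep_x, sub_eq_iff_eq_add'] at this
  rw [this]
  congr 1
  rw [map_smul, map_mul, freeRep_x, hV.freeRep_gammaHalfPow, smul_mul_assoc, one_mul, smul_smul,
    add_comm m n]
  congr 1
  have habs : |m| = l := by
    rcases hl with rfl | rfl <;> simp
  rw [habs, ← qpow_mul_intCast, bracketCoeff]
  congr 2
  · rcases hl with rfl | rfl
    · push_cast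
      rfl
    · push_cast
      rw [mul_neg, qnum_neg, neg_div_neg_eq]
  · push_cast
    ring

theorem IsLevelModule.xOp_xOp_self (hV : IsLevelModule C h κ V) (i : ι) (m n : ℤ) :
    xOp C h V 1 i m * xOp C h V (-1) i n - xOp C h V (-1) i n * xOp C h V 1 i m
      = (qpow h (C.d i) - qpow h (-C.d i))⁻¹ •
        (qpow h (κ / 2) ^ (m - n) • psiOp C h V i (m + n)
          - (qpow h (κ / 2))⁻¹ ^ (m - n) • phiOp C h V i (m + n)) := by
  have := freeRep_rel (V := V) (Rel.x_plus_minus (C := C) (h := h) i m n)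
  rw [map_sub, map_mul, map_mul, map_smul, map_sub, map_mul, map_mul, hV.freeRep_gammaHalfPow,
    hV.freeRep_gammaHalfPow, smul_mul_assoc, smul_mul_assoc, one_mul, one_mul] at this
  rw [inv_zpow', neg_sub]
  exact this

/-! ## The `Z`-operators -/

theorem IsLevelModule.coeffCommute_em (hV : IsLevelModule C h κ V) (ε ε' : ℤˣ) (i j : ι) :
    CoeffCommute (zField C h κ V ε i).em (zField C h κ V ε' j).em :=
  (coeffCommute_mk_smul (hV.commute_aOp_neg_natCast i j) _ _).formalExp

theorem IsLevelModule.coeffCommute_ep (hV : IsLevelModule C h κ V) (ε ε' : ℤˣ) (i j : ι) :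
    CoeffCommute (zField C h κ V ε i).ep (zField C h κ V ε' j).ep :=
  (coeffCommute_mk_smul (hV.commute_aOp_natCast i j) _ _).formalExp

/-- The exponent of the contraction of two fields. -/
def contraction (h : ℂ) (κ a : ℚ) (ε ε' : ℤˣ) : ℂ⟦X⟧ :=
  PowerSeries.mk fun n => -expCoeff h κ ε' n * bracketCoeff h κ a ε n

theorem IsLevelModule.em_mul_x (hV : IsLevelModule C h κ V) (ε ε' : ℤˣ) (i j : ι) (r : ℕ) (p : ℤ) :
    coeff r (zField C h κ V ε' j).em * (zField C h κ V ε i).x p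
      = ∑ y ∈ antidiagonal r, coeff y.1 (formalExp (contraction h κ (C.form j i) ε ε')) •
          ((zField C h κ V ε i).x (p - y.1) * coeff y.2 (zField C h κ V ε' j).em) := by
  refine coeff_formalExp_mul_field ?_ (coeffCommute_mk_smul (hV.commute_aOp_neg_natCast j j) _ _)
    ?_ ?_ r p
  · simp
  · simp [contraction, bracketCoeff]
  · intro l p
    simp only [coeff_mk, contraction, zField]
    rw [smul_mul_assoc, hV.aOp_xOp ε j i (Or.inr rfl), smul_add, smul_smul, mul_smul_comm,
      sub_eq_add_neg]

/-- The two factors `q^{∓κn/2}`, one from `E_-` and one from the bracket with `x`, multiply to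
`q^{∓κn}`, which rescales the argument; the signs square to one. -/
theorem formalExp_contraction_self (a : ℚ) (ε : ℤˣ) :
    formalExp (contraction h κ a ε ε)
      = PowerSeries.rescale (qpow h (-(((ε : ℤ) : ℚ) * κ))) (qPochhammerPow h κ a) := by
  rw [qPochhammerPow, rescale_formalExp]
  congr 1
  ext n
  rw [coeff_rescale, contraction, coeff_mk, coeff_mk, expCoeff, bracketCoeff, ← qpow_mul_natCast,
    show -(((ε : ℤ) : ℚ) * κ) * n
      = -(((ε : ℤ) : ℚ) * κ * n / 2) + -(((ε : ℤ) : ℚ) * κ * n / 2) by ring, qpow_add]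
  have hε : ((ε : ℤ) : ℂ) * ((ε : ℤ) : ℂ) = 1 := by
    rcases Int.units_eq_one_or ε with rfl | rfl <;> simp
  generalize ((ε : ℤ) : ℂ) = e at hε
  calc _ = -(e * e) * (qpow h (-(((ε : ℤ) : ℚ) * κ * n / 2)) / qnum h (κ * n) *
        (qnum h (a * n) / n) * qpow h (-(((ε : ℤ) : ℚ) * κ * n / 2))) := by ring
    _ = _ := by rw [hε]; ring

/-- For opposite signs the two half powers of `q` cancel, and the product of signs is `-1`, which
turns `a` into `-a`. -/
theorem formalExp_contraction_neg (a : ℚ) (ε : ℤˣ) :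
    formalExp (contraction h κ a ε (-ε)) = qPochhammerPow h κ (-a) := by
  rw [qPochhammerPow]
  congr 1
  ext n
  rw [contraction, coeff_mk, coeff_mk, expCoeff, bracketCoeff, neg_mul a, qnum_neg]
  have hε : ((ε : ℤ) : ℂ) * ((ε : ℤ) : ℂ) = 1 := by
    rcases Int.units_eq_one_or ε with rfl | rfl <;> simp
  have hq : qpow h (-(((-ε : ℤˣ) : ℤ) * κ * n / 2)) * qpow h (-(((ε : ℤ) : ℚ) * κ * n / 2)) = 1 := by
    rw [← qpow_add]
    push_cast
    rw [show -(-((ε : ℤ) : ℚ) * κ * n / 2) + -(((ε : ℤ) : ℚ) * κ * n / 2) = 0 by ring, qpow_zero]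
  have hneg : (((-ε : ℤˣ) : ℤ) : ℂ) = -((ε : ℤ) : ℂ) := by push_cast; rfl
  rw [hneg]
  calc _ = (((ε : ℤ) : ℂ) * ((ε : ℤ) : ℂ)) *
        (qpow h (-(((-ε : ℤˣ) : ℤ) * κ * n / 2)) * qpow h (-(((ε : ℤ) : ℚ) * κ * n / 2))) *
        (qnum h (a * n) / n / qnum h (κ * n)) := by ring
    _ = _ := by rw [hε, hq]; ring

/-- The choice of the exponents is made for this: the central term `[κm]` cancels the denominator in
`expCoeff`, leaving minus the bracket with `x`. Cancelling it needs `[κm] ≠ 0`, hence `κ ≠ 0` and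
`q` not a root of unity. -/
theorem IsLevelModule.commute_aOp_op (hV : IsLevelModule C h κ V)
    (hq : ∀ n : ℕ, 0 < n → Complex.exp h ^ n ≠ 1) (hκ : κ ≠ 0) (ε : ℤˣ) (i j : ι) (m : ℕ) (n : ℤ) :
    Commute (aOp C h V i m) ((zField C h κ V ε j).op hV.locallyBounded n) := by
  rcases eq_or_ne m 0 with rfl | hm
  · simp
  refine DressedField.commute_op _ _ (m := m) (c := bracketCoeff h κ (C.form i j) ε m) ?_ ?_ ?_ n
  · refine mul_coeff_formalExp_of_bracket ?_
      (coeffCommute_mk_smul (hV.commute_aOp_neg_natCast j j) _ _)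
      (μ := fun r => if r = m then -bracketCoeff h κ (C.form i j) ε m else 0) ?_
    · simp
    · intro r
      rw [coeff_mk, mul_smul_comm, hV.aOp_aOp, smul_add, smul_smul, smul_mul_assoc]
      congr 2
      rw [neg_neg]
      rcases eq_or_ne r m with rfl | hr
      · rw [if_pos rfl, if_pos rfl, expCoeff, bracketCoeff]
        have := qnum_mul_natCast_ne_zero hq hκ hm
        push_cast
        field_simp
      · rw [if_neg (by exact_mod_cast hr.symm), if_neg hr, mul_zero]
  · intro p
    exact hV.aOp_xOp ε i j (Or.inl rfl) p
  · intro s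
    refine commute_coeff_formalExp (fun r => ?_) s
    rw [coeff_mk]
    exact (hV.commute_aOp_natCast i j m r).smul_right _

theorem IsLevelModule.commute_ep_op (hV : IsLevelModule C h κ V)
    (hq : ∀ n : ℕ, 0 < n → Complex.exp h ^ n ≠ 1) (hκ : κ ≠ 0) (ε ε' : ℤˣ) (i j : ι) (s : ℕ)
    (n : ℤ) :
    Commute (coeff s (zField C h κ V ε i).ep)
      ((zField C h κ V ε' j).op hV.locallyBounded n) := by
  refine (commute_coeff_formalExp (fun r => ?_) s).symm
  rw [coeff_mk]
  exact (hV.commute_aOp_op hq hκ ε' i j r n).symm.smul_right _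

theorem IsLevelModule.eventually_finsum (hV : IsLevelModule C h κ V)
    (hq : ∀ n : ℕ, 0 < n → Complex.exp h ^ n ≠ 1) (hκ : κ ≠ 0) (ε ε' : ℤˣ) (i j : ι) {P : ℂ⟦X⟧}
    (hP : formalExp (contraction h κ (C.form j i) ε ε') = P) (m n : ℤ) (v : V) :
    ∀ᶠ B : ℕ in Filter.atTop,
      ∑ᶠ u : ℕ, coeff u P • (zField C h κ V ε i).op hV.locallyBounded (m - u)
          ((zField C h κ V ε' j).op hV.locallyBounded (n + u) v)
        = DressedField.normalSum (zField C h κ V ε i) (zField C h κ V ε' j)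
          (fun m n => xOp C h V ε i m * xOp C h V ε' j n) B m n v := by
  subst hP
  exact DressedField.eventually_finsum_smul_op_op hV.locallyBounded (hV.em_mul_x ε ε' i j)
    (hV.commute_ep_op hq hκ ε ε' i j) m n v

/-- The same for the product in the opposite order. -/
theorem IsLevelModule.eventually_finsum_swap (hV : IsLevelModule C h κ V)
    (hq : ∀ n : ℕ, 0 < n → Complex.exp h ^ n ≠ 1) (hκ : κ ≠ 0) (ε ε' : ℤˣ) (i j : ι) {P : ℂ⟦X⟧}
    (hP : formalExp (contraction h κ (C.form i j) ε' ε) = P) (m n : ℤ) (v : V) :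
    ∀ᶠ B : ℕ in Filter.atTop,
      ∑ᶠ u : ℕ, coeff u P • (zField C h κ V ε' j).op hV.locallyBounded (n - u)
          ((zField C h κ V ε i).op hV.locallyBounded (m + u) v)
        = DressedField.normalSum (zField C h κ V ε i) (zField C h κ V ε' j)
          (fun m n => xOp C h V ε' j n * xOp C h V ε i m) B m n v := by
  filter_upwards [hV.eventually_finsum hq hκ ε' ε j i hP n m v] with B hB
  rw [hB, ← DressedField.normalSum_swap (hV.coeffCommute_em ε ε' i j)
    (hV.coeffCommute_ep ε ε' i j)]

theorem IsLevelModule.support_finite (hV : IsLevelModule C h κ V) (ε ε' : ℤˣ) (i j : ι) (P : ℂ⟦X⟧)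
    (m n : ℤ) (v : V) :
    (Function.support fun u : ℕ => coeff u P • (zField C h κ V ε i).op hV.locallyBounded (m - u)
      ((zField C h κ V ε' j).op hV.locallyBounded (n + u) v)).Finite := by
  obtain ⟨N, hN⟩ := hV.locallyBounded v
  exact (Finset.finite_toSet _).subset (DressedField.support_smul_op_op_subset hV.locallyBounded P m
    n hN (B := (N - n + 1).toNat) (by omega))

theorem finsum_smul_sub {M : Type*} [AddCommGroup M] [Module ℂ M] {f g : ℕ → M} (c : ℂ)
    (hf : f.support.Finite) (hg : g.support.Finite) :
    ∑ᶠ u, (c • f u - g u) = c • ∑ᶠ u, f u - ∑ᶠ u, g u := by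
  rw [smul_finsum' c hf]
  exact finsum_sub_distrib (hf.subset (Function.support_const_smul_subset c f)) hg

theorem finsum_sub_smul {M : Type*} [AddCommGroup M] [Module ℂ M] {f g : ℕ → M} (c : ℂ)
    (hf : f.support.Finite) (hg : g.support.Finite) :
    ∑ᶠ u, (f u - c • g u) = ∑ᶠ u, f u - c • ∑ᶠ u, g u := by
  rw [smul_finsum' c hg]
  exact finsum_sub_distrib hf (hg.subset (Function.support_const_smul_subset c g))

theorem IsLevelModule.same_sign (hV : IsLevelModule C h κ V)
    (hq : ∀ n : ℕ, 0 < n → Complex.exp h ^ n ≠ 1) (hκ : κ ≠ 0) (ε : ℤˣ) (i j : ι) {P : ℂ⟦X⟧}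
    (hP : formalExp (contraction h κ (C.form i j) ε ε) = P) (v : V) :
    mulSeriesWZ P (mulLinear 1 (qpow h (((ε : ℤ) : ℚ) * C.form i j))
        (prodZW ((zField C h κ V ε i).op hV.locallyBounded)
          ((zField C h κ V ε j).op hV.locallyBounded) v))
      = mulSeriesZW P (mulLinear (qpow h (((ε : ℤ) : ℚ) * C.form i j)) 1
        (prodWZ ((zField C h κ V ε j).op hV.locallyBounded)
          ((zField C h κ V ε i).op hV.locallyBounded) v)) := by
  have hP' : formalExp (contraction h κ (C.form j i) ε ε) = P := by
    rw [CartanDatum.form_comm, hP]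
  set c := qpow h (((ε : ℤ) : ℚ) * C.form i j) with hc
  funext a b
  have hL : mulSeriesWZ P (mulLinear 1 c (prodZW ((zField C h κ V ε i).op hV.locallyBounded)
      ((zField C h κ V ε j).op hV.locallyBounded) v)) a b
      = ∑ᶠ u : ℕ, coeff u P • (zField C h κ V ε i).op hV.locallyBounded (-a + 1 - u)
          ((zField C h κ V ε j).op hV.locallyBounded (-b + u) v)
        - c • ∑ᶠ u : ℕ, coeff u P • (zField C h κ V ε i).op hV.locallyBounded (-a - u)
          ((zField C h κ V ε j).op hV.locallyBounded (-b + 1 + u) v) := by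
    refine Eq.trans (finsum_congr fun u => ?_)
      (finsum_sub_smul c (hV.support_finite ε ε i j P (-a + 1) (-b) v)
        (hV.support_finite ε ε i j P (-a) (-b + 1) v))
    simp only [mulLinear, prodZW, one_smul]
    rw [smul_sub, smul_comm c, show -(a + u - 1) = -a + 1 - (u : ℤ) by ring,
      show -(b - u) = -b + (u : ℤ) by ring, show -(a + u) = -a - (u : ℤ) by ring,
      show -(b - u - 1) = -b + 1 + (u : ℤ) by ring]
  have hR : mulSeriesZW P (mulLinear c 1 (prodWZ ((zField C h κ V ε j).op hV.locallyBounded)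
      ((zField C h κ V ε i).op hV.locallyBounded) v)) a b
      = c • ∑ᶠ u : ℕ, coeff u P • (zField C h κ V ε j).op hV.locallyBounded (-b - u)
          ((zField C h κ V ε i).op hV.locallyBounded (-a + 1 + u) v)
        - ∑ᶠ u : ℕ, coeff u P • (zField C h κ V ε j).op hV.locallyBounded (-b + 1 - u)
          ((zField C h κ V ε i).op hV.locallyBounded (-a + u) v) := by
    refine Eq.trans (finsum_congr fun u => ?_)
      (finsum_smul_sub c (hV.support_finite ε ε j i P (-b) (-a + 1) v)
        (hV.support_finite ε ε j i P (-b + 1) (-a) v))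
    simp only [mulLinear, prodWZ, one_smul]
    rw [smul_sub, smul_comm c, show -(b + u - 1) = -b + 1 - (u : ℤ) by ring,
      show -(a - u) = -a + (u : ℤ) by ring, show -(b + u) = -b - (u : ℤ) by ring,
      show -(a - u - 1) = -a + 1 + (u : ℤ) by ring]
  -- One box for all four normally ordered products; after this the linear factors are mode shifts
  -- and the bare relation applies termwise.
  obtain ⟨B, h₁, h₂, h₃, h₄⟩ := ((hV.eventually_finsum hq hκ ε ε i j hP' (-a + 1) (-b) v).and
    ((hV.eventually_finsum hq hκ ε ε i j hP' (-a) (-b + 1) v).and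
    ((hV.eventually_finsum_swap hq hκ ε ε i j hP (-a + 1) (-b) v).and
    (hV.eventually_finsum_swap hq hκ ε ε i j hP (-a) (-b + 1) v)))).exists
  rw [hL, hR, h₁, h₂, h₃, h₄]
  have e := fun G => DressedField.normalSum_shift (zField C h κ V ε i) (zField C h κ V ε j)
    G B 1 0 (-a) (-b) v
  have e' := fun G => DressedField.normalSum_shift (zField C h κ V ε i) (zField C h κ V ε j)
    G B 0 1 (-a) (-b) v
  simp only [add_zero] at e e'
  rw [← e, ← e, ← e', ← e', ← DressedField.normalSum_smul, ← DressedField.normalSum_smul,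
    ← DressedField.normalSum_sub, ← DressedField.normalSum_sub]
  simp only [hc, xOp_xOp]

/-! ### Cancellation on the delta functions and the mixed relation. -/

theorem expCoeff_one (n : ℕ) : expCoeff h κ 1 n = (qpow h (κ / 2) ^ n)⁻¹ / qnum h (κ * n) := by
  rw [expCoeff, ← qpow_mul_natCast, ← qpow_neg]
  push_cast
  ring_nf

theorem expCoeff_neg_one (n : ℕ) :
    expCoeff h κ (-1) n = -(qpow h (κ / 2) ^ n / qnum h (κ * n)) := by
  rw [expCoeff, ← qpow_mul_natCast]
  push_cast
  ring_nf

/-- The `n`-th exponent that two merged dressing series leave on the support of a delta function; it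
matches, up to sign, the constant in `ψ_i` and `φ_i`. -/
theorem sq_sub_inv_sq_div_qnum (hq : ∀ n : ℕ, 0 < n → Complex.exp h ^ n ≠ 1) (hκ : κ ≠ 0) {n : ℕ}
    (hn : n ≠ 0) :
    (qpow h (κ / 2) ^ n * qpow h (κ / 2) ^ n
        - (qpow h (κ / 2) ^ n)⁻¹ * (qpow h (κ / 2) ^ n)⁻¹) / qnum h (κ * n)
      = qpow h 1 - qpow h (-1) := by
  rw [div_eq_iff (qnum_mul_natCast_ne_zero hq hκ hn), qnum,
    mul_div_cancel₀ _ (qpow_sub_qpow_neg_ne_zero hq one_ne_zero), ← qpow_mul_natCast, ← qpow_neg,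
    ← qpow_add, ← qpow_add]
  ring_nf

theorem IsLevelModule.eventually_normalSum_psiOp (hV : IsLevelModule C h κ V)
    (hq : ∀ n : ℕ, 0 < n → Complex.exp h ^ n ≠ 1) (hκ : κ ≠ 0) (i : ι) (m n : ℤ) (v : V) :
    ∀ᶠ B : ℕ in Filter.atTop,
      DressedField.normalSum (zField C h κ V 1 i) (zField C h κ V (-1) i)
          (fun m n => qpow h (κ / 2) ^ (m - n) • psiOp C h V i (m + n)) B m n v
        = qpow h (κ / 2) ^ (m - n) • if m + n = 0 then kOp C h V i v else 0 := by
  refine DressedField.eventually_normalSum_psi hV.locallyBounded (qpow_ne_zero h _)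
    (psiOp_mem C h V i) (psiOp_natCast C h V i) (fun l hl => psiOp_of_neg C h V i hl) ?_ ?_ m n v
  · simp only [zField]
    rw [scaleX_expSeries, scaleX_expSeries, expSeries_mul (by simp)
      (hV.commute_aOp_neg_natCast i i), expSeries_eq_one (by simp)]
    intro n hn
    rw [expCoeff_one, expCoeff_neg_one, inv_pow]
    ring
  · simp only [zField]
    rw [scaleX_expSeries, scaleX_expSeries, expSeries_mul (by simp)
      (hV.commute_aOp_natCast i i), expSeries_mul (by simp)
      (hV.commute_aOp_natCast i i), expSeries_eq_one (by simp)]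
    intro n hn
    rw [expCoeff_one, expCoeff_neg_one, inv_pow, ← sq_sub_inv_sq_div_qnum hq hκ hn]
    ring

theorem IsLevelModule.eventually_normalSum_phiOp (hV : IsLevelModule C h κ V)
    (hq : ∀ n : ℕ, 0 < n → Complex.exp h ^ n ≠ 1) (hκ : κ ≠ 0) (i : ι) (m n : ℤ) (v : V) :
    ∀ᶠ B : ℕ in Filter.atTop,
      DressedField.normalSum (zField C h κ V 1 i) (zField C h κ V (-1) i)
          (fun m n => (qpow h (κ / 2))⁻¹ ^ (m - n) • phiOp C h V i (m + n)) B m n v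
        = (qpow h (κ / 2))⁻¹ ^ (m - n) • if m + n = 0 then kInvOp C h V i v else 0 := by
  refine DressedField.eventually_normalSum_phi hV.locallyBounded (inv_ne_zero (qpow_ne_zero h _))
    (phiOp_mem C h V i) (phiOp_neg_natCast C h V i) (fun l hl => phiOp_of_pos C h V i hl)
    ?_ ?_ ?_ m n v
  · intro r
    simp only [zField]
    rw [scaleX_expSeries, scaleX_expSeries, expSeries_mul (by simp)
      (hV.commute_aOp_neg_natCast i i)]
    refine commute_coeff_formalExp (fun l => ?_) r
    rw [coeff_mk]
    exact (commute_kInvOp C h V (commute_kOp_aOp C h V i i _)).smul_right _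
  · simp only [zField]
    rw [scaleX_expSeries, scaleX_expSeries, expSeries_mul (by simp)
      (hV.commute_aOp_neg_natCast i i), expSeries_mul (by simp)
      (hV.commute_aOp_neg_natCast i i), expSeries_eq_one (by simp)]
    intro n hn
    rw [expCoeff_one, expCoeff_neg_one, inv_inv, inv_pow, ← neg_sub (qpow h 1),
      ← sq_sub_inv_sq_div_qnum hq hκ hn]
    ring
  · simp only [zField]
    rw [scaleX_expSeries, scaleX_expSeries, expSeries_mul (by simp)
      (hV.commute_aOp_natCast i i), expSeries_eq_one (by simp)]
    intro n hn
    rw [expCoeff_one, expCoeff_neg_one, inv_inv, inv_pow]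
    ring

theorem zpow_smul_ite_eq_delta_smul {M : Type*} [AddCommGroup M] [Module ℂ M] (a : ℚ) (m n : ℤ)
    (w : M) :
    (qpow h (a / 2) ^ (m - n) • if m + n = 0 then w else 0)
      = delta (qpow h (-a)) (-m) (-n) • w := by
  rw [delta]
  split_ifs with h₁ h₂ h₂
  -- On `m + n = 0` the half power `q^{a/2}` is raised to `2m`, giving `q^{am} = (q^{-a})^{-m}`.
  · rw [show m - n = 2 * m by omega, ← qpow_mul_intCast, ← qpow_mul_intCast]
    push_cast
    ring_nf
  · omega
  · omega
  · rw [smul_zero, zero_smul]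

theorem IsLevelModule.mixed_sign [DecidableEq ι] (hV : IsLevelModule C h κ V)
    (hq : ∀ n : ℕ, 0 < n → Complex.exp h ^ n ≠ 1) (hκ : κ ≠ 0) (i j : ι) {P : ℂ⟦X⟧}
    (hP : formalExp (contraction h κ (C.form j i) 1 (-1)) = P)
    (hP' : formalExp (contraction h κ (C.form i j) (-1) 1) = P) (v : V) (m n : ℤ) :
    mulSeriesWZ P (prodZW ((zField C h κ V 1 i).op hV.locallyBounded)
          ((zField C h κ V (-1) j).op hV.locallyBounded) v) (-m) (-n)
        - mulSeriesZW P (prodWZ ((zField C h κ V (-1) j).op hV.locallyBounded)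
          ((zField C h κ V 1 i).op hV.locallyBounded) v) (-m) (-n)
      = if i = j then
          (qpow h (C.d i) - qpow h (-C.d i))⁻¹ •
            (delta (qpow h (-κ)) (-m) (-n) • kOp C h V i v
              - delta (qpow h κ) (-m) (-n) • kInvOp C h V i v)
        else 0 := by
  have hL : mulSeriesWZ P (prodZW ((zField C h κ V 1 i).op hV.locallyBounded)
      ((zField C h κ V (-1) j).op hV.locallyBounded) v) (-m) (-n)
      = ∑ᶠ u : ℕ, coeff u P • (zField C h κ V 1 i).op hV.locallyBounded (m - u)
          ((zField C h κ V (-1) j).op hV.locallyBounded (n + u) v) := by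
    refine finsum_congr fun u => ?_
    rw [prodZW, show -(-m + u) = m - (u : ℤ) by ring, show -(-n - u) = n + (u : ℤ) by ring]
  have hR : mulSeriesZW P (prodWZ ((zField C h κ V (-1) j).op hV.locallyBounded)
      ((zField C h κ V 1 i).op hV.locallyBounded) v) (-m) (-n)
      = ∑ᶠ u : ℕ, coeff u P • (zField C h κ V (-1) j).op hV.locallyBounded (n - u)
          ((zField C h κ V 1 i).op hV.locallyBounded (m + u) v) := by
    refine finsum_congr fun u => ?_
    rw [prodWZ, show -(-n + u) = n - (u : ℤ) by ring, show -(-m - u) = m + (u : ℤ) by ring]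
  obtain ⟨B, h₁, h₂, h₃, h₄⟩ := ((hV.eventually_finsum hq hκ 1 (-1) i j hP m n v).and
    ((hV.eventually_finsum_swap hq hκ 1 (-1) i j hP' m n v).and
    ((hV.eventually_normalSum_psiOp hq hκ i m n v).and
    (hV.eventually_normalSum_phiOp hq hκ i m n v)))).exists
  rw [hL, hR, h₁, h₂, ← DressedField.normalSum_sub]
  split_ifs with hij
  · subst hij
    simp only [hV.xOp_xOp_self]
    rw [DressedField.normalSum_smul, DressedField.normalSum_sub, h₃, h₄,
      zpow_smul_ite_eq_delta_smul, ← qpow_neg, ← neg_div, zpow_smul_ite_eq_delta_smul, neg_neg]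
  · simp only [xOp_xOp_of_ne C h V hij]
    simp [DressedField.normalSum]

end LevelRelations

end QuantumZ

end

/-- `q = e^h` is not a root of unity, `κ` is a nonzero rational level. -/
theorem theorem2p2 {ι : Type*} [Fintype ι] [DecidableEq ι] (C : QuantumZ.CartanDatum ι)
    (h : ℂ) (hq : ∀ n : ℕ, 0 < n → Complex.exp h ^ n ≠ 1)
    (κ : ℚ) (hκ : κ ≠ 0)
    (V : Type*) [AddCommGroup V] [Module ℂ V] [Module (QuantumZ.Uq C h) V]
    [IsScalarTower ℂ (QuantumZ.Uq C h) V]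
    (hV : QuantumZ.IsLevelModule C h κ V) :
    ∃ Z : ℤˣ → ι → ℤ → Module.End ℂ V,
      QuantumZ.IsZOperator C h κ Z ∧
      QuantumZ.QuantumZRelations C h κ
        (fun i => Algebra.lsmul ℂ ℂ V (QuantumZ.Uq.k C h i))
        (fun i => Algebra.lsmul ℂ ℂ V (QuantumZ.Uq.kInv C h i))
        Z := by
  refine ⟨fun ε i => (QuantumZ.zField C h κ V ε i).op hV.locallyBounded, ?_, ?_, ?_, ?_⟩
  · intro ε i n v
    rw [QuantumZ.zTerm_eq]
    exact ⟨QuantumZ.DressedField.support_term_finite _ hV.locallyBounded n v, rfl⟩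
  · intro ε i v
    obtain ⟨N, hN⟩ := hV.locallyBounded v
    exact ⟨N, fun n hn => hN n hn _ (QuantumZ.DressedField.op_mem _ _ n)⟩
  · intro ε i j v
    exact hV.same_sign hq hκ ε i j (QuantumZ.formalExp_contraction_self _ _) v
  · intro i j v a b
    have := hV.mixed_sign hq hκ i j (P := QuantumZ.qPochhammerPow h κ (-C.form i j))
      (by rw [QuantumZ.formalExp_contraction_neg, QuantumZ.CartanDatum.form_comm])
      (by simpa using QuantumZ.formalExp_contraction_neg (h := h) (κ := κ) (C.form i j) (-1))
      v (-a) (-b)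
    simp only [neg_neg] at this
    exact this
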